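/- Let $n,d\ge 1$, $0\le p\le 1$, let $a_{si}\in\mathbb C$ ($1\le s\le n$, $1\le i\le d-1$) satisfy $\sum_{s,i}|a_{si}|^2=1$, and let $$|\psi\rangle_{A_1\cdots A_n}=\sqrt p\,\sum_{s=1}^{n}\sum_{i=1}^{d-1}a_{si}|0\cdots 0\,i\,0\cdots 0\rangle+\sqrt{1-p}\,|0\cdots0\rangle\in(\mathbb C^d)^{\otimes n}$$ ($i$ at position $s$) be a superposition of an $n$-qudit generalized $W$-class state and the vacuum (a GWV state). Let $r\ge1$ and let $P,P_0,\dots,P_{r-1}$ be nonempty, pairwise disjoint sets of qudits (a partition of some subset of $\{A_1,\dots,A_n\}$). Let $\rho_{PP_j}$ be the reduced density matrix of $|\psi\rangle$ on $P\cup P_j$, with bipartition $P\,|\,P_j$, and $\rho_{P|P_0\cdots P_{r-1}}$ its reduced density matrix on $P\cup P_0\cup\dots\cup P_{r-1}$, with bipartition $P\,|\,P_0\cdots P_{r-1}$. For $q>0$ and a bipartite pure state with $\rho_A=\operatorname{tr}_B|\phi\rangle\langle\phi|$ put $T_q(|\phi\rangle)=\frac{1-\operatorname{tr}\rho_A^q}{q-1}$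 if $q\neq1$, and $T_1(|\phi\rangle)=-\operatorname{tr}\rho_A\log\rho_A$ (the limit $q\to1$). The Tsallis-$q$ entanglement of assistance of a bipartite state $\rho$ is $$T_q^a(\rho)=\max\sum_i p_iT_q(|\psi_i\rangle),$$ the maximum (supremum) being over all finite pure state decompositions $\rho=\sum_ip_i|\psi_i\rangle\langle\psi_i|$ with $p_i\ge 0$, $\sum_i p_i=1$ and unit vectors $|\psi_i\rangle$. For an integer $j\ge0$ let $\omega_H(j)$ be the number of ones in the binary expansion of $j$. Let $q\in\left[\frac{5-\sqrt{13}}2,2\right]\cup\left[3,\frac{5+\sqrt{13}}2\right]$ and $\mu\in(0,1]$. (1) Let $0<k\le1$ and suppose $k\,T_q^a(\rho_{PP_j})\ge T_q^a(\rho_{PP_{j+1}})$ for $j=0,\dots,r-2$. Then $$\left[T_q^a(\rho_{P|P_0\cdots P_{r-1}})\right]^\mu\le\sum_{j=0}^{r-1}K_\mu^{\omega_H(j)}\left[T_q^a(\rho_{PP_j})\right]^\mu,\qquad K_\mu=\frac{(1+k)^\mu-1}{k^\mu}.$$ (2) For every GWV state and all $P,P_0,\dots,P_{r-1}$ as above,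 without a condition of the form in (1), the sets $P_0,\dots,P_{r-1}$ can be relabelled so that $T_q^a(\rho_{PP_0})\ge\dots\ge T_q^a(\rho_{PP_{r-1}})$ and $$\left[T_q^a(\rho_{P|P_0\cdots P_{r-1}})\right]^\mu\le\sum_{j=0}^{r-1}(2^\mu-1)^{\omega_H(j)}\left[T_q^a(\rho_{PP_j})\right]^\mu.$$ -/

import Mathlib

open scoped BigOperators ComplexConjugate

namespace GWV

noncomputable section

/-- The (possibly unnormalised) `n`-qudit generalized `W`-class vector
`∑_s ∑_{i ≠ 0} a_{s i} |0 … i … 0⟩` (the level `i` at position `s`), in coordinates with respect to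
the computational basis `|x⟩`, `x : Fin n → Fin d`. -/
def wClass {n d : ℕ} [NeZero d] (a : Fin n → Fin d → ℂ) (x : Fin n → Fin d) : ℂ :=
  ∑ s : Fin n, ∑ i ∈ Finset.univ.erase (0 : Fin d), if x = Pi.single s i then a s i else 0

/-- The superposition `√p |W⟩ + √(1 - p) |0 … 0⟩` of a generalized `W`-class state and the vacuum. -/
def gwv {n d : ℕ} [NeZero d] (p : ℝ) (a : Fin n → Fin d → ℂ) (x : Fin n → Fin d) : ℂ :=
  (Real.sqrt p : ℂ) * wClass a x + (Real.sqrt (1 - p) : ℂ) * (if x = 0 then 1 else 0)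

/-- For disjoint sets `P`, `R` of qudits: the basis label of the whole system with part `x` on `P`,
`y` on `R` and `z` on all the other qudits. -/
def glue {n d : ℕ} {P R : Finset (Fin n)} (x : P → Fin d) (y : R → Fin d)
    (z : {i : Fin n // i ∉ P ∧ i ∉ R} → Fin d) : Fin n → Fin d := fun i =>
  if hP : i ∈ P then x ⟨i, hP⟩ else if hR : i ∈ R then y ⟨i, hR⟩ else z ⟨i, hP, hR⟩

/-- The reduced density matrix `ρ_{P|R}` of the pure state `ψ` on the disjoint parties `P` and `R`:
the partial trace of `|ψ⟩⟨ψ|` over all qudits outside `P ∪ R`, as a matrix on the tensor product of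
the spaces of `P` and of `R`. -/
def reduced {n d : ℕ} (ψ : (Fin n → Fin d) → ℂ) (P R : Finset (Fin n)) :
    Matrix ((P → Fin d) × (R → Fin d)) ((P → Fin d) × (R → Fin d)) ℂ := fun x y =>
  ∑ z : {i : Fin n // i ∉ P ∧ i ∉ R} → Fin d,
    ψ (glue x.1 x.2 z) * conj (ψ (glue y.1 y.2 z))

/-- The rank one operator `|ψ⟩⟨ψ|`. -/
def projector {ι : Type} (ψ : ι → ℂ) : Matrix ι ι ℂ := fun x y => ψ x * conj (ψ y)

/-- The reduced density matrix `ρ_A = tr_B |ψ⟩⟨ψ|` of a bipartite vector. -/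
def marginal {α β : Type} [Fintype β] (ψ : α × β → ℂ) : Matrix α α ℂ := fun x y => ∑ b : β, projector ψ (x, b) (y, b)

theorem marginal_isHermitian {α β : Type} [Fintype β] (ψ : α × β → ℂ) :
    (marginal ψ).IsHermitian := by
  ext x y
  simp [marginal, projector, Matrix.conjTranspose_apply, mul_comm]

/-- The Tsallis-`q` entropy of a density matrix, `(1 - tr ρ^q) / (q - 1)` for `q ≠ 1`; for `q = 1`
its limit, the von Neumann entropy `- tr ρ log ρ`. -/
def tsallisEntropy {α : Type} [Fintype α] [DecidableEq α] (q : ℝ) {ρ : Matrix α α ℂ}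
    (hρ : ρ.IsHermitian) : ℝ :=
  if q = 1 then ∑ i, Real.negMulLog (hρ.eigenvalues i)
  else (1 - ∑ i, hρ.eigenvalues i ^ q) / (q - 1)

/-- The Tsallis-`q` entanglement of a bipartite pure state. -/
def tsallisPure {α β : Type} [Fintype α] [DecidableEq α] [Fintype β] (q : ℝ)
    (ψ : α × β → ℂ) : ℝ :=
  tsallisEntropy q (marginal_isHermitian ψ)

/-- `{w_i, |ψ_i⟩}` is a pure state decomposition of `ρ`. -/
structure IsPureDecomposition {ι : Type} [Fintype ι] (ρ : Matrix ι ι ℂ) {N : ℕ} (w : Fin N → ℝ)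
    (ψ : Fin N → ι → ℂ) : Prop where
  nonneg : ∀ i, 0 ≤ w i
  sum_eq_one : ∑ i, w i = 1
  normalized : ∀ i, ∑ x, ‖ψ i x‖ ^ 2 = 1
  decomp : ρ = ∑ i, (w i : ℂ) • projector (ψ i)

/-- The Tsallis-`q` entanglement of assistance of a bipartite density matrix: the largest average
Tsallis-`q` entanglement over its finite pure state decompositions (of any length). For a density
matrix the set is nonempty by the spectral theorem, and bounded above because the entropy is bounded
in a fixed finite dimension. -/
def tsallisAssistance {α β : Type} [Fintype α] [DecidableEq α] [Fintype β] (q : ℝ)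
    (ρ : Matrix (α × β) (α × β) ℂ) : ℝ :=
  sSup {t : ℝ | ∃ (N : ℕ) (w : Fin N → ℝ) (ψ : Fin N → α × β → ℂ),
    IsPureDecomposition ρ w ψ ∧ t = ∑ i, w i * tsallisPure q (ψ i)}

/-- The Hamming weight of the binary expansion of `j`. -/
def hammingWeight (j : ℕ) : ℕ := (Nat.digits 2 j).count 1

/-- `K_μ = ((1 + k)^μ - 1) / k^μ`. -/
def weightK (k μ : ℝ) : ℝ := ((1 + k) ^ μ - 1) / k ^ μ

end

end GWV

/-! ### Scalar power inequalities weighted by the binary digit count -/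

namespace GWV

/-! The core is the polygamy inequality `tsallisAssistance_biUnion_le`: the assistance of P against
the union of the parts is at most the sum of the assistances of P against each part. The power μ and
the Hamming weights then come from a purely scalar inequality, `sum_fin_rpow_le`.

For polygamy, let A and B_j be the squared W-amplitudes carried by P and by P_j. Tracing out the
other qudits leaves a state supported on the span of two vectors, the shared W-vector and the
vacuum. Hence every vector of positive weight in a decomposition has the form α(|W⟩|0⟩ + |0⟩|W⟩) +
β|0⟩|0⟩. Its marginal has rank at most two, and its nonzero spectrum is governed by the product δ =
|α|⁴ A ∑ B_j, so its entanglement is f(δ) with f = `binaryTsallis q`.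

Two properties of f suffice. It is concave in δ when (q - 2)(q - 3) ≥ 0, and f(0) = 0, so f(|α|⁴ A ∑
B_j) ≤ ∑ f(|α|⁴ A B_j). It is convex in the concurrence C = 2√δ when q² - 5q + 3 ≤ 0, so f(m²δ) ≤ m
f(δ) for m ∈ [0, 1]. The prescribed range of q satisfies both conditions.

The same coefficients α, β, read on P and P_j alone, give vectors of squared norm m ≤ 1 whose
mixture is the reduced state up to a vacuum term. Normalising them costs nothing by the second
property. The result is a decomposition of the smaller state whose average entanglement bounds the
j-th summand. -/

theorem weightK_one (μ : ℝ) : weightK 1 μ = 2 ^ μ - 1 := by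
  norm_num [weightK]

theorem weightK_nonneg {k μ : ℝ} (hk : 0 < k) (hμ : 0 ≤ μ) : 0 ≤ weightK k μ :=
  div_nonneg (sub_nonneg.2 (Real.one_le_rpow (by linarith) hμ)) (Real.rpow_nonneg hk.le μ)

/-- Unit increments of a concave function decrease. -/
theorem rpow_succ_sub_le {μ c s : ℝ} (hμ0 : 0 ≤ μ) (hμ1 : μ ≤ 1) (hc : 0 ≤ c) (hcs : c ≤ s) :
    (s + 1) ^ μ - s ^ μ ≤ (c + 1) ^ μ - c ^ μ := by
  have hconc := (Real.concaveOn_rpow hμ0 hμ1).2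
  have hL : 0 < s + 1 - c := by linarith
  have hc' : c ∈ Set.Ici (0 : ℝ) := hc
  have hs' : s + 1 ∈ Set.Ici (0 : ℝ) := by simp only [Set.mem_Ici]; linarith
  -- Both s and c + 1 are convex combinations of c and s + 1, with the two weights exchanged; adding
  -- the two concavity inequalities gives the claim.
  have hsum : 1 / (s + 1 - c) + (s - c) / (s + 1 - c) = 1 := by field_simp; ring
  have hsum' : (s - c) / (s + 1 - c) + 1 / (s + 1 - c) = 1 := by field_simp; ring
  have h0 : 0 ≤ 1 / (s + 1 - c) := by positivity
  have h1 : 0 ≤ (s - c) / (s + 1 - c) := div_nonneg (by linarith) hL.le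
  have e1 := hconc hc' hs' h0 h1 hsum
  have e2 := hconc hc' hs' h1 h0 hsum'
  simp only [smul_eq_mul] at e1 e2
  have f1 : 1 / (s + 1 - c) * c + (s - c) / (s + 1 - c) * (s + 1) = s := by field_simp; ring
  have f2 : (s - c) / (s + 1 - c) * c + 1 / (s + 1 - c) * (s + 1) = c + 1 := by field_simp; ring
  rw [f1] at e1
  rw [f2] at e2
  have := congrArg (· * c ^ μ) hsum
  have := congrArg (· * (s + 1) ^ μ) hsum
  simp only at *
  nlinarith

/-- After division by y^μ this compares the unit increment of the power at x / y with the one at k⁻¹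
≤ x / y, and the latter is exactly K_μ. -/
theorem add_rpow_le_weightK {k μ x y : ℝ} (hk : 0 < k) (hμ0 : 0 < μ) (hμ1 : μ ≤ 1)
    (hx : 0 ≤ x) (hy : 0 ≤ y) (hyx : y ≤ k * x) :
    (x + y) ^ μ ≤ x ^ μ + weightK k μ * y ^ μ := by
  rcases hy.eq_or_lt with rfl | hy
  · simp [Real.zero_rpow hμ0.ne']
  have h := rpow_succ_sub_le hμ0.le hμ1 (inv_nonneg.2 hk.le)
    (show k⁻¹ ≤ x / y by rw [inv_le_iff_one_le_mul₀ hk, div_mul_eq_mul_div, le_div_iff₀ hy]; linarith)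
  have hK : weightK k μ = (k⁻¹ + 1) ^ μ - k⁻¹ ^ μ := by
    have : k⁻¹ + 1 = (1 + k) / k := by field_simp
    rw [weightK, this, Real.div_rpow (by linarith) hk.le, Real.inv_rpow hk.le, sub_div, one_div]
  rw [← hK] at h
  have h2 : x / y + 1 = (x + y) / y := by field_simp
  rw [h2, Real.div_rpow (by linarith) hy.le, Real.div_rpow hx hy.le, ← sub_div,
    div_le_iff₀ (Real.rpow_pos_of_pos hy μ)] at h
  linarith

theorem hammingWeight_two_mul (j : ℕ) : hammingWeight (2 * j) = hammingWeight j := by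
  rcases Nat.eq_zero_or_pos j with rfl | hj
  · simp
  · simp [hammingWeight, Nat.digits_base_mul one_lt_two hj]

theorem hammingWeight_two_mul_add_one (j : ℕ) :
    hammingWeight (2 * j + 1) = hammingWeight j + 1 := by
  have := Nat.digits_add_two_add_one 0 (2 * j)
  rw [hammingWeight, this]
  simp [hammingWeight, Nat.add_mod]
  congr 3
  omega

theorem sum_range_two_mul {M : Type*} [AddCommMonoid M] (f : ℕ → M) (N : ℕ) :
    ∑ j ∈ Finset.range (2 * N), f j = ∑ j ∈ Finset.range N, (f (2 * j) + f (2 * j + 1)) := by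
  induction N with
  | zero => simp
  | succ N ih => rw [Finset.sum_range_succ, ← ih, mul_add, mul_one, Finset.sum_range_succ,
      Finset.sum_range_succ, add_assoc]

/-- Merging the neighbours 2j and 2j + 1 halves the length. The odd neighbour pays one factor K_μ,
just as the last binary digit adds one to its Hamming weight. -/
theorem sum_range_two_pow_rpow_le {k μ : ℝ} (hk : 0 < k) (hk1 : k ≤ 1) (hμ0 : 0 < μ) (hμ1 : μ ≤ 1)
    (m : ℕ) (t : ℕ → ℝ) (ht : ∀ j, 0 ≤ t j) (hkt : ∀ j, t (j + 1) ≤ k * t j) :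
    (∑ j ∈ Finset.range (2 ^ m), t j) ^ μ ≤
      ∑ j ∈ Finset.range (2 ^ m), weightK k μ ^ hammingWeight j * t j ^ μ := by
  induction m generalizing t with
  | zero => simp [hammingWeight]
  | succ m ih =>
    rw [pow_succ', sum_range_two_mul, sum_range_two_mul]
    refine (ih (fun j => t (2 * j) + t (2 * j + 1)) (fun j => add_nonneg (ht _) (ht _))
      fun j => ?_).trans (Finset.sum_le_sum fun j _ => ?_)
    -- The merged sequence keeps the ratio condition; k ≤ 1 is what makes the original sequence
    -- decreasing.
    · have h1 := hkt (2 * j + 1)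
      have h2 := hkt (2 * j + 2)
      have h3 : t (2 * j + 2) ≤ t (2 * j + 1) :=
        h1.trans (mul_le_of_le_one_left (ht _) hk1)
      have h4 : t (2 * j + 1) ≤ t (2 * j) := (hkt _).trans (mul_le_of_le_one_left (ht _) hk1)
      have e : 2 * (j + 1) = 2 * j + 2 := by ring
      rw [e]
      nlinarith
    · rw [hammingWeight_two_mul, hammingWeight_two_mul_add_one, pow_succ, mul_assoc, ← mul_add]
      exact mul_le_mul_of_nonneg_left (add_rpow_le_weightK hk hμ0 hμ1 (ht _) (ht _) (hkt _))
        (pow_nonneg (weightK_nonneg hk hμ0.le) _)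

theorem sum_fin_rpow_le {k μ : ℝ} (hk : 0 < k) (hk1 : k ≤ 1) (hμ0 : 0 < μ) (hμ1 : μ ≤ 1)
    {r : ℕ} (t : Fin r → ℝ) (ht : ∀ j, 0 ≤ t j)
    (hkt : ∀ i j : Fin r, (j : ℕ) = (i : ℕ) + 1 → t j ≤ k * t i) :
    (∑ j, t j) ^ μ ≤ ∑ j : Fin r, weightK k μ ^ hammingWeight j * t j ^ μ := by
  -- Padding by zeros up to length 2 ^ r preserves the ratio condition and, since μ > 0, adds
  -- nothing to either side.
  set u : ℕ → ℝ := fun j => if h : j < r then t ⟨j, h⟩ else 0 with hu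
  have hut : ∀ j : Fin r, u j = t j := fun j => by simp [hu]
  have hu0 : ∀ j, r ≤ j → u j = 0 := fun j hj => by simp [hu, hj]
  have hun : ∀ j, 0 ≤ u j := fun j => by
    by_cases h : j < r
    · simp only [hu, h, dif_pos]; exact ht _
    · simp [hu, h]
  have huk : ∀ j, u (j + 1) ≤ k * u j := fun j => by
    by_cases h : j + 1 < r
    · have h' : j < r := by omega
      simp only [hu, h, h', dif_pos]
      exact hkt _ _ rfl
    · rw [hu0 _ (not_lt.1 h)]
      exact mul_nonneg hk.le (hun j)
  have key := sum_range_two_pow_rpow_le hk hk1 hμ0 hμ1 r u hun huk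
  have hr : Finset.range r ⊆ Finset.range (2 ^ r) :=
    Finset.range_subset_range.2 Nat.lt_two_pow_self.le
  rw [← Finset.sum_subset hr fun j _ hj => hu0 j (by simpa using hj),
    ← Finset.sum_subset hr fun j _ hj => by
      rw [hu0 j (by simpa using hj), Real.zero_rpow hμ0.ne', mul_zero],
    Finset.sum_range, Finset.sum_range] at key
  simpa only [hut] using key

end GWV

/-! ### Monotonicity of secants of powers -/

namespace GWV

open Set Filter Topology

theorem hasDerivAt_one_add_rpow (p : ℝ) {D : ℝ} (hD : D ∈ Ico (0 : ℝ) 1) :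
    HasDerivAt (fun t : ℝ => (1 + t) ^ p) (p * (1 + D) ^ (p - 1)) D := by
  have := ((hasDerivAt_id D).const_add 1).rpow_const (p := p) (Or.inl (by simp; linarith [hD.1]))
  simpa using this

theorem hasDerivAt_one_sub_rpow (p : ℝ) {D : ℝ} (hD : D ∈ Ico (0 : ℝ) 1) :
    HasDerivAt (fun t : ℝ => (1 - t) ^ p) (-(p * (1 - D) ^ (p - 1))) D := by
  have := ((hasDerivAt_id D).const_sub 1).rpow_const (p := p)
    (Or.inl (by simp only [id]; linarith [hD.2]))
  simpa using this

theorem nonneg_of_hasDerivAt_nonneg {f f' : ℝ → ℝ} (h0 : f 0 = 0)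
    (hf : ∀ D ∈ Ico (0 : ℝ) 1, HasDerivAt f (f' D) D) (hf' : ∀ D ∈ Ioo (0 : ℝ) 1, 0 ≤ f' D)
    {D : ℝ} (hD : D ∈ Ico (0 : ℝ) 1) : 0 ≤ f D := by
  have hmono : MonotoneOn f (Ico 0 1) := by
    refine monotoneOn_of_deriv_nonneg (convex_Ico 0 1)
      (fun x hx => (hf x hx).continuousAt.continuousWithinAt)
      (fun x hx => (hf x (interior_subset hx)).differentiableAt.differentiableWithinAt)
      fun x hx => ?_
    rw [(hf x (interior_subset hx)).deriv]
    exact hf' x (by simpa using hx)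
  simpa [h0] using hmono (by simp) hD hD.1

/-- With D = tanh x, the quotient of the difference by the sum is tanh (s x); the content is tanh (s
x) ≤ s tanh x. -/
theorem rpow_sub_le_of_one_le {s D : ℝ} (hs : 1 ≤ s) (hD : D ∈ Ico (0 : ℝ) 1) :
    (1 + D) ^ s - (1 - D) ^ s ≤ s * D * ((1 + D) ^ s + (1 - D) ^ s) := by
  have key := nonneg_of_hasDerivAt_nonneg
    (f := fun t => (1 - t) ^ s - (1 + t) ^ s + s * t * ((1 + t) ^ s + (1 - t) ^ s))
    (f' := fun D => s * (1 + s) * D * ((1 + D) ^ (s - 1) - (1 - D) ^ (s - 1)))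
    (by simp) (fun D hD => ?_) (fun D hD => ?_) hD
  · linarith
  · have ha := hasDerivAt_one_add_rpow s hD
    have hb := hasDerivAt_one_sub_rpow s hD
    refine HasDerivAt.congr_deriv ((hb.sub ha).add (((hasDerivAt_id D).const_mul s).mul (ha.add hb))) ?_
    have e1 : (1 + D) ^ s = (1 + D) ^ (s - 1) * (1 + D) := by
      rw [Real.rpow_sub_one (by linarith [hD.1])]; field_simp [(by linarith [hD.1] : 1 + D ≠ 0)]
    have e2 : (1 - D) ^ s = (1 - D) ^ (s - 1) * (1 - D) := by
      rw [Real.rpow_sub_one (by linarith [hD.2])]; field_simp [(by linarith [hD.2] : 1 - D ≠ 0)]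
    simp only [id, e1, e2]
    ring
  · have := Real.rpow_le_rpow (by linarith [hD.2]) (by linarith [hD.1] : 1 - D ≤ 1 + D)
      (by linarith : 0 ≤ s - 1)
    exact mul_nonneg (mul_nonneg (by nlinarith) hD.1.le) (by linarith)

theorem rpow_sub_le_of_le_one {s D : ℝ} (hs1 : s ≤ 1) (hD : D ∈ Ico (0 : ℝ) 1) :
    (1 + D) ^ s - (1 - D) ^ s ≤ D * ((1 + D) ^ s + (1 - D) ^ s) := by
  have ha : 0 < 1 + D := by linarith [hD.1]
  have hb : 0 < 1 - D := by linarith [hD.2]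
  have h := Real.rpow_le_rpow_of_exponent_le
    ((one_le_div hb).2 (by linarith [hD.1] : 1 - D ≤ 1 + D)) hs1
  rw [Real.rpow_one, Real.div_rpow ha.le hb.le,
    div_le_div_iff₀ (Real.rpow_pos_of_pos hb s) hb] at h
  linarith

theorem mul_rpow_sub_le_of_nonneg {s c D : ℝ} (hs : 0 ≤ s) (hc : s ^ 2 ≤ c) (hc' : s ≤ c)
    (hD : D ∈ Ico (0 : ℝ) 1) :
    s * ((1 + D) ^ s - (1 - D) ^ s) ≤ c * D * ((1 + D) ^ s + (1 - D) ^ s) := by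
  have hpos : 0 ≤ D * ((1 + D) ^ s + (1 - D) ^ s) :=
    mul_nonneg hD.1 (add_nonneg (Real.rpow_nonneg (by linarith [hD.1]) _)
      (Real.rpow_nonneg (by linarith [hD.2]) _))
  rcases le_total 1 s with h | h
  · nlinarith [rpow_sub_le_of_one_le h hD]
  · nlinarith [rpow_sub_le_of_le_one h hD]

/-- In the variable D = tanh x this reads r tanh (r x) ≤ c tanh x. The left side is even in r, so
negative exponents reduce to positive ones. -/
theorem mul_rpow_sub_le {r c D : ℝ} (hc : r ^ 2 ≤ c) (hc' : |r| ≤ c) (hD : D ∈ Ico (0 : ℝ) 1) :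
    r * ((1 + D) ^ r - (1 - D) ^ r) ≤ c * D * ((1 + D) ^ r + (1 - D) ^ r) := by
  rcases le_total 0 r with h | h
  · exact mul_rpow_sub_le_of_nonneg h hc ((le_abs_self r).trans hc') hD
  · have key := mul_rpow_sub_le_of_nonneg (neg_nonneg.2 h) (by simpa using hc)
      ((neg_le_abs r).trans hc') hD
    have ha : 0 < 1 + D := by linarith [hD.1]
    have hb : 0 < 1 - D := by linarith [hD.2]
    rw [Real.rpow_neg ha.le, Real.rpow_neg hb.le] at key
    have hA := Real.rpow_pos_of_pos ha r
    have hB := Real.rpow_pos_of_pos hb r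
    have := mul_le_mul_of_nonneg_right key (mul_pos hA hB).le
    field_simp at this
    linarith

/-- The divided difference `((1 + D)^p - (1 - D)^p) / (p D)`. -/
noncomputable def rpowSecant (p D : ℝ) : ℝ := ((1 + D) ^ p - (1 - D) ^ p) / (p * D)

theorem hasDerivAt_rpowSecant {p D : ℝ} (hp : p ≠ 0) (hD : D ∈ Ioo (0 : ℝ) 1) :
    HasDerivAt (rpowSecant p)
      ((D * ((1 + D) ^ (p - 1) + (1 - D) ^ (p - 1)) - ((1 + D) ^ p - (1 - D) ^ p) / p) / D ^ 2)
      D := by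
  have hD' := Ioo_subset_Ico_self hD
  have h0 := hD.1.ne'
  refine HasDerivAt.congr_deriv (((hasDerivAt_one_add_rpow p hD').sub (hasDerivAt_one_sub_rpow p hD')).div
    ((hasDerivAt_id D).const_mul p) (mul_ne_zero hp h0)) ?_
  simp only [Pi.sub_apply]
  field_simp
  ring

theorem monotoneOn_rpowSecant {p : ℝ} (hp : p ≠ 0) (h : 0 ≤ (p - 1) * (p - 2)) :
    MonotoneOn (rpowSecant p) (Ioo 0 1) := by
  refine monotoneOn_of_deriv_nonneg (convex_Ioo 0 1)
      (fun x hx => (hasDerivAt_rpowSecant hp hx).continuousAt.continuousWithinAt)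
      (fun x hx => (hasDerivAt_rpowSecant hp
        (interior_subset hx)).differentiableAt.differentiableWithinAt) fun x hx => ?_
  rw [interior_Ioo] at hx
  rw [(hasDerivAt_rpowSecant hp hx).deriv]
  refine div_nonneg ?_ (sq_nonneg _)
  refine nonneg_of_hasDerivAt_nonneg
    (f := fun D => D * ((1 + D) ^ (p - 1) + (1 - D) ^ (p - 1)) - ((1 + D) ^ p - (1 - D) ^ p) / p)
    (f' := fun D => D * ((p - 1) * ((1 + D) ^ (p - 2) - (1 - D) ^ (p - 2))))
    (by simp) (fun D hD => ?_) (fun D hD => ?_) (Ioo_subset_Ico_self hx)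
  · have ha := hasDerivAt_one_add_rpow (p - 1) hD
    have hb := hasDerivAt_one_sub_rpow (p - 1) hD
    have ha' := hasDerivAt_one_add_rpow p hD
    have hb' := hasDerivAt_one_sub_rpow p hD
    refine HasDerivAt.congr_deriv (((hasDerivAt_id D).mul (ha.add hb)).sub ((ha'.sub hb').div_const p)) ?_
    simp only [id, Pi.add_apply, show p - 1 - 1 = p - 2 by ring]
    field_simp
    ring
  · refine mul_nonneg hD.1.le ?_
    rcases le_total p 1 with h1 | h1
    · have := Real.rpow_le_rpow_of_nonpos (by linarith [hD.2]) (by linarith [hD.1] : 1 - D ≤ 1 + D)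
        (by linarith : p - 2 ≤ 0)
      nlinarith
    · rcases h1.eq_or_lt with rfl | h1
      · simp
      have := Real.rpow_le_rpow (by linarith [hD.2]) (by linarith [hD.1] : 1 - D ≤ 1 + D)
        (by nlinarith : 0 ≤ p - 2)
      nlinarith

/-- This is the sign of the derivative of √(1 - D²) times the secant. Differentiating once more
reduces it to `mul_rpow_sub_le` with r = p - 1 and c = p + 2, where r² ≤ c is precisely p² - 3p - 1
≤ 0. -/
theorem mul_rpow_add_le {p D : ℝ} (hp : p ≠ 0) (h : p ^ 2 - 3 * p - 1 ≤ 0)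
    (hD : D ∈ Ico (0 : ℝ) 1) :
    D * ((1 + D) ^ (p - 1) + (1 - D) ^ (p - 1)) * (1 - D ^ 2) ≤
      ((1 + D) ^ p - (1 - D) ^ p) / p := by
  have hpow : ∀ {D : ℝ}, D ∈ Ico (0 : ℝ) 1 → (1 + D) ^ p = (1 + D) ^ (p - 1) * (1 + D) ∧
      (1 - D) ^ p = (1 - D) ^ (p - 1) * (1 - D) := fun {D} hD => by
    constructor
    · rw [Real.rpow_sub_one (by linarith [hD.1])]; field_simp [(by linarith [hD.1] : 1 + D ≠ 0)]
    · rw [Real.rpow_sub_one (by linarith [hD.2])]; field_simp [(by linarith [hD.2] : 1 - D ≠ 0)]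
  have key := nonneg_of_hasDerivAt_nonneg
    (f := fun D => ((1 + D) ^ p - (1 - D) ^ p) / p -
      D * ((1 + D) ^ p * (1 - D) + (1 - D) ^ p * (1 + D)))
    (f' := fun D => D * ((3 + (p - 1)) * D * ((1 + D) ^ (p - 1) + (1 - D) ^ (p - 1)) -
      (p - 1) * ((1 + D) ^ (p - 1) - (1 - D) ^ (p - 1))))
    (by simp) (fun D hD => ?_) (fun D hD => ?_) hD
  · obtain ⟨e1, e2⟩ := hpow hD
    have : D * ((1 + D) ^ (p - 1) + (1 - D) ^ (p - 1)) * (1 - D ^ 2) =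
      D * ((1 + D) ^ p * (1 - D) + (1 - D) ^ p * (1 + D)) := by rw [e1, e2]; ring
    rw [this]
    linarith
  · have ha := hasDerivAt_one_add_rpow p hD
    have hb := hasDerivAt_one_sub_rpow p hD
    have hi := hasDerivAt_id D
    refine HasDerivAt.congr_deriv (((ha.sub hb).div_const p).sub (hi.mul ((ha.mul (hi.const_sub 1)).add
      (hb.mul (hi.const_add 1))))) ?_
    obtain ⟨e1, e2⟩ := hpow hD
    simp only [id, e1, e2]
    field_simp
    ring
  · refine mul_nonneg hD.1.le (sub_nonneg.2 (mul_rpow_sub_le (by linarith) ?_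
      (Ioo_subset_Ico_self hD)))
    rw [abs_le]
    constructor <;> nlinarith

theorem antitoneOn_sqrt_mul_rpowSecant {p : ℝ} (hp : p ≠ 0) (h : p ^ 2 - 3 * p - 1 ≤ 0) :
    AntitoneOn (fun D => √(1 - D ^ 2) * rpowSecant p D) (Ioo 0 1) := by
  have hder : ∀ D ∈ Ioo (0 : ℝ) 1, HasDerivAt (fun D => √(1 - D ^ 2) * rpowSecant p D)
      ((D * ((1 + D) ^ (p - 1) + (1 - D) ^ (p - 1)) * (1 - D ^ 2) -
        ((1 + D) ^ p - (1 - D) ^ p) / p) / (√(1 - D ^ 2) * D ^ 2)) D := fun D hD => by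
    have hpos : 0 < 1 - D ^ 2 := by nlinarith [hD.1, hD.2]
    have h0 := hD.1.ne'
    have hs := Real.sqrt_pos.2 hpos
    have hsq := Real.sq_sqrt hpos.le
    refine HasDerivAt.congr_deriv ((((hasDerivAt_pow 2 D).const_sub 1).sqrt hpos.ne').mul (hasDerivAt_rpowSecant hp hD)) ?_
    simp only [rpowSecant]
    field_simp
    rw [hsq]
    ring
  refine antitoneOn_of_deriv_nonpos (convex_Ioo 0 1)
      (fun x hx => (hder x hx).continuousAt.continuousWithinAt)
      (fun x hx => (hder x (interior_subset hx)).differentiableAt.differentiableWithinAt)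
      fun x hx => ?_
  rw [interior_Ioo] at hx
  rw [(hder x hx).deriv]
  exact div_nonpos_of_nonpos_of_nonneg
    (sub_nonpos.2 (mul_rpow_add_le hp h (Ioo_subset_Ico_self hx))) (by positivity)

end GWV

/-! ### Concavity and convexity of the binary Tsallis entropy -/

namespace GWV

open Set Filter Topology

/-- The Tsallis-`q` entropy of the pair of weights `x`, `y`. -/
noncomputable def pairEntropy (q x y : ℝ) : ℝ :=
  if q = 1 then x.negMulLog + y.negMulLog else (1 - (x ^ q + y ^ q)) / (q - 1)

theorem pairEntropy_comm (q x y : ℝ) : pairEntropy q x y = pairEntropy q y x := by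
  simp only [pairEntropy, add_comm]

/-- The Tsallis-`q` entropy of a binary distribution whose weights have product `δ`. -/
noncomputable def binaryTsallis (q δ : ℝ) : ℝ :=
  pairEntropy q ((1 - √(1 - 4 * δ)) / 2) ((1 + √(1 - 4 * δ)) / 2)

theorem pairEntropy_eq_binaryTsallis (q : ℝ) {x y : ℝ} (h : x + y = 1) :
    pairEntropy q x y = binaryTsallis q (x * y) := by
  wlog hxy : x ≤ y generalizing x y
  · rw [pairEntropy_comm, mul_comm]
    exact this (by linarith) (le_of_not_ge hxy)
  have : √(1 - 4 * (x * y)) = y - x := by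
    rw [show 1 - 4 * (x * y) = (y - x) ^ 2 by rw [← one_pow 2, ← h]; ring,
      Real.sqrt_sq (sub_nonneg.2 hxy)]
  rw [binaryTsallis, this]
  congr 1 <;> linarith

theorem binaryTsallis_zero {q : ℝ} (hq : 0 < q) : binaryTsallis q 0 = 0 := by
  have := pairEntropy_eq_binaryTsallis q (zero_add 1)
  rw [zero_mul] at this
  rw [← this]
  simp [pairEntropy, Real.zero_rpow hq.ne']

/-- As x + y = 1, the entropy for q ≠ 1 is minus the difference quotient at 1 of the map q ↦ x^q +
y^q. -/
theorem tendsto_pairEntropy_one {x y : ℝ} (hx : 0 ≤ x) (hy : 0 ≤ y) (h : x + y = 1) :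
    Tendsto (fun q => pairEntropy q x y) (𝓝[≠] 1) (𝓝 (pairEntropy 1 x y)) := by
  have hd : ∀ {x : ℝ}, 0 ≤ x → HasDerivAt (fun q : ℝ => x ^ q) (x * Real.log x) 1 := by
    intro x hx
    rcases hx.eq_or_lt with rfl | hx
    · have : (fun q : ℝ => (0 : ℝ) ^ q) =ᶠ[𝓝 1] fun _ => 0 := by
        filter_upwards [lt_mem_nhds one_pos] with q hq
        exact Real.zero_rpow hq.ne'
      simpa using (hasDerivAt_const (1 : ℝ) (0 : ℝ)).congr_of_eventuallyEq this
    · simpa using Real.hasStrictDerivAt_const_rpow hx 1 |>.hasDerivAt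
  have := ((hd hx).add (hd hy)).neg.tendsto_slope
  have e : pairEntropy 1 x y = -(x * Real.log x + y * Real.log y) := by
    simp [pairEntropy, Real.negMulLog]; ring
  rw [e]
  refine this.congr' ?_
  filter_upwards [self_mem_nhdsWithin] with q hq
  rw [pairEntropy, if_neg (show ¬q = 1 from hq), slope_def_field]
  simp only [Pi.neg_apply, Pi.add_apply, Real.rpow_one, h]
  ring

theorem sqrt_one_sub_le_one {δ : ℝ} (hδ : 0 ≤ δ) : √(1 - 4 * δ) ≤ 1 :=
  Real.sqrt_le_one.2 (by linarith)

theorem tendsto_binaryTsallis_one {δ : ℝ} (hδ : 0 ≤ δ) :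
    Tendsto (fun q => binaryTsallis q δ) (𝓝[≠] 1) (𝓝 (binaryTsallis 1 δ)) :=
  tendsto_pairEntropy_one (by linarith [sqrt_one_sub_le_one hδ])
    (by linarith [Real.sqrt_nonneg (1 - 4 * δ)]) (by ring)

theorem continuous_binaryTsallis {q : ℝ} (hq : 0 < q) (hq1 : q ≠ 1) :
    Continuous (binaryTsallis q) := by
  have h : ∀ x : ℝ, x ≠ 0 ∨ 0 ≤ q := fun _ => Or.inr hq.le
  unfold binaryTsallis pairEntropy
  simp only [hq1, if_false]
  refine Continuous.div_const (continuous_const.sub (Continuous.add ?_ ?_)) _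
  · exact Continuous.rpow_const (by fun_prop) fun _ => h _
  · exact Continuous.rpow_const (by fun_prop) fun _ => h _

theorem hasDerivAt_binaryTsallis {q δ : ℝ} (hq1 : q ≠ 1) (hδ : δ ∈ Ioo (0 : ℝ) (1 / 4)) :
    HasDerivAt (binaryTsallis q) (q / 2 ^ (q - 1) * rpowSecant (q - 1) √(1 - 4 * δ)) δ := by
  have hpos : 0 < 1 - 4 * δ := by linarith [hδ.2]
  have hs := Real.sqrt_pos.2 hpos
  have hs1 : √(1 - 4 * δ) < 1 := by rw [Real.sqrt_lt' one_pos]; linarith [hδ.1]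
  have hD : HasDerivAt (fun t : ℝ => √(1 - 4 * t)) (-2 / √(1 - 4 * δ)) δ := by
    refine ((((hasDerivAt_id δ).const_mul 4).const_sub 1).sqrt hpos.ne').congr_deriv ?_
    simp only [id]
    field_simp
    ring
  have hx := (((hD.const_sub 1).div_const 2).rpow_const (p := q) (Or.inl (by linarith)))
  have hy := (((hD.const_add 1).div_const 2).rpow_const (p := q) (Or.inl (by linarith)))
  have : binaryTsallis q = fun δ => (1 - (((1 - √(1 - 4 * δ)) / 2) ^ q +
      ((1 + √(1 - 4 * δ)) / 2) ^ q)) / (q - 1) := by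
    ext δ
    rw [binaryTsallis, pairEntropy, if_neg hq1]
  rw [this]
  refine (((hx.add hy).const_sub 1).div_const (q - 1)).congr_deriv ?_
  have hq' := sub_ne_zero.2 hq1
  have h2 : (0 : ℝ) < 2 ^ (q - 1) := by positivity
  rw [Real.div_rpow (by linarith) two_pos.le, Real.div_rpow (by linarith) two_pos.le, rpowSecant]
  field_simp
  ring

/-- The derivative in δ is a positive multiple of the secant at D = √(1 - 4δ), which increases with
D and so decreases with δ. -/
theorem concaveOn_binaryTsallis_of_ne {q : ℝ} (hq : 0 < q) (hq1 : q ≠ 1)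
    (h : 0 ≤ (q - 2) * (q - 3)) : ConcaveOn ℝ (Icc 0 (1 / 4)) (binaryTsallis q) := by
  refine AntitoneOn.concaveOn_of_deriv (convex_Icc _ _) (continuous_binaryTsallis hq hq1).continuousOn
    ?_ ?_
  · rw [interior_Icc]
    exact fun x hx => (hasDerivAt_binaryTsallis hq1 hx).differentiableAt.differentiableWithinAt
  · rw [interior_Icc]
    intro x hx y hy hxy
    rw [(hasDerivAt_binaryTsallis hq1 hx).deriv, (hasDerivAt_binaryTsallis hq1 hy).deriv]
    have hmem : ∀ {x : ℝ}, x ∈ Ioo (0 : ℝ) (1 / 4) → √(1 - 4 * x) ∈ Ioo (0 : ℝ) 1 := fun {x} hx =>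
      ⟨Real.sqrt_pos.2 (by linarith [hx.2]), by rw [Real.sqrt_lt' one_pos]; linarith [hx.1]⟩
    refine mul_le_mul_of_nonneg_left (monotoneOn_rpowSecant (sub_ne_zero.2 hq1) (by linarith)
      (hmem hy) (hmem hx) (Real.sqrt_le_sqrt (by linarith))) (by positivity)

/-- With D = √(1 - C²), the derivative in C is a positive multiple of C = √(1 - D²) times the
secant, which is antitone in D. For the exponent p = q - 1, the condition p² - 3p - 1 ≤ 0 becomes q²
- 5q + 3 ≤ 0. -/
theorem convexOn_binaryTsallis_sq_of_ne {q : ℝ} (hq : 0 < q) (hq1 : q ≠ 1)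
    (h : q ^ 2 - 5 * q + 3 ≤ 0) : ConvexOn ℝ (Icc 0 1) (fun C => binaryTsallis q (C ^ 2 / 4)) := by
  have hmem : ∀ {x : ℝ}, x ∈ Ioo (0 : ℝ) 1 → √(1 - x ^ 2) ∈ Ioo (0 : ℝ) 1 := fun {x} hx =>
    ⟨Real.sqrt_pos.2 (by nlinarith [hx.1, hx.2]), by
      rw [Real.sqrt_lt' one_pos]; nlinarith [hx.1, hx.2]⟩
  have hder : ∀ C ∈ Ioo (0 : ℝ) 1, HasDerivAt (fun C => binaryTsallis q (C ^ 2 / 4))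
      (q / 2 ^ (q - 1) / 2 * (√(1 - √(1 - C ^ 2) ^ 2) * rpowSecant (q - 1) √(1 - C ^ 2))) C := by
    intro C hC
    have hδ : C ^ 2 / 4 ∈ Ioo (0 : ℝ) (1 / 4) :=
      ⟨by have := hC.1; positivity, by nlinarith [hC.1, hC.2]⟩
    refine ((hasDerivAt_binaryTsallis hq1 hδ).comp C
      ((hasDerivAt_pow 2 C).div_const 4)).congr_deriv ?_
    rw [Real.sq_sqrt (by nlinarith [hC.1, hC.2]), sub_sub_cancel, Real.sqrt_sq hC.1.le,
      mul_div_cancel₀ (C ^ 2) (four_ne_zero)]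
    push_cast
    ring
  refine MonotoneOn.convexOn_of_deriv (convex_Icc _ _)
    ((continuous_binaryTsallis hq hq1).comp (by fun_prop)).continuousOn ?_ ?_
  · rw [interior_Icc]
    exact fun x hx => (hder x hx).differentiableAt.differentiableWithinAt
  · rw [interior_Icc]
    intro x hx y hy hxy
    rw [(hder x hx).deriv, (hder y hy).deriv]
    exact mul_le_mul_of_nonneg_left (antitoneOn_sqrt_mul_rpowSecant (sub_ne_zero.2 hq1)
      (by linarith) (hmem hy) (hmem hx)
      (Real.sqrt_le_sqrt (by nlinarith [hx.1]))) (by positivity)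

/-- Both shape conditions hold around q = 1, so concavity and convexity pass to the limit there. -/
theorem eventually_near_one : ∀ᶠ q : ℝ in 𝓝[≠] 1,
    0 < q ∧ q ≠ 1 ∧ 0 ≤ (q - 2) * (q - 3) ∧ q ^ 2 - 5 * q + 3 ≤ 0 := by
  filter_upwards [self_mem_nhdsWithin, mem_nhdsWithin_of_mem_nhds
    (Ioo_mem_nhds (show (3 / 4 : ℝ) < 1 by norm_num) (show (1 : ℝ) < 2 by norm_num))] with q h1 hq
  exact ⟨by linarith [hq.1], h1, by nlinarith [hq.1, hq.2], by nlinarith [hq.1, hq.2]⟩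

theorem concaveOn_binaryTsallis {q : ℝ} (hq : 0 < q) (h : 0 ≤ (q - 2) * (q - 3)) :
    ConcaveOn ℝ (Icc 0 (1 / 4)) (binaryTsallis q) := by
  by_cases hq1 : q = 1
  · subst hq1
    refine ⟨convex_Icc _ _, fun x hx y hy a b ha hb hab => ?_⟩
    refine le_of_tendsto_of_tendsto
      (((tendsto_binaryTsallis_one hx.1).const_smul a).add
        ((tendsto_binaryTsallis_one hy.1).const_smul b))
      (tendsto_binaryTsallis_one (convex_Icc (0 : ℝ) (1 / 4) hx hy ha hb hab).1) ?_
    filter_upwards [eventually_near_one] with q hq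
    exact (concaveOn_binaryTsallis_of_ne hq.1 hq.2.1 hq.2.2.1).2 hx hy ha hb hab
  · exact concaveOn_binaryTsallis_of_ne hq hq1 h

theorem convexOn_binaryTsallis_sq {q : ℝ} (hq : 0 < q) (h : q ^ 2 - 5 * q + 3 ≤ 0) :
    ConvexOn ℝ (Icc 0 1) (fun C => binaryTsallis q (C ^ 2 / 4)) := by
  by_cases hq1 : q = 1
  · subst hq1
    have ht : ∀ C : ℝ, Tendsto (fun q => binaryTsallis q (C ^ 2 / 4)) (𝓝[≠] 1)
      (𝓝 (binaryTsallis 1 (C ^ 2 / 4))) := fun C => tendsto_binaryTsallis_one (by positivity)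
    refine ⟨convex_Icc _ _, fun x hx y hy a b ha hb hab => ?_⟩
    refine le_of_tendsto_of_tendsto (ht _) (((ht x).const_smul a).add ((ht y).const_smul b)) ?_
    filter_upwards [eventually_near_one] with q hq
    exact (convexOn_binaryTsallis_sq_of_ne hq.1 hq.2.1 hq.2.2.2).2 hx hy ha hb hab
  · exact convexOn_binaryTsallis_sq_of_ne hq hq1 h

theorem binaryTsallis_sum_le {q : ℝ} (hq : 0 < q) (h : 0 ≤ (q - 2) * (q - 3)) {ι : Type*}
    (s : Finset ι) (δ : ι → ℝ) (hδ : ∀ i ∈ s, 0 ≤ δ i) (hs : ∑ i ∈ s, δ i ≤ 1 / 4) :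
    binaryTsallis q (∑ i ∈ s, δ i) ≤ ∑ i ∈ s, binaryTsallis q (δ i) := by
  set t := ∑ i ∈ s, δ i with ht
  have ht0 : 0 ≤ t := Finset.sum_nonneg hδ
  have h0 := binaryTsallis_zero hq
  rcases ht0.eq_or_lt with h' | h'
  · rw [← h', h0]
    refine Finset.sum_nonneg fun i hi => ?_
    rw [(Finset.sum_eq_zero_iff_of_nonneg hδ).1 (ht.symm.trans h'.symm) i hi, h0]
  -- Concavity on the chord from 0 to t, where the function vanishes at 0.
  · have : ∀ i ∈ s, δ i / t * binaryTsallis q t ≤ binaryTsallis q (δ i) := fun i hi => by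
      have hi1 : δ i ≤ t := Finset.single_le_sum hδ hi
      have := (concaveOn_binaryTsallis hq h).2 (x := t) (y := 0) ⟨ht0, hs⟩ ⟨le_rfl, by norm_num⟩
        (div_nonneg (hδ i hi) ht0) (sub_nonneg.2 ((div_le_one h').2 hi1)) (by ring)
      simpa [h0, h'.ne'] using this
    refine le_trans (le_of_eq ?_) (Finset.sum_le_sum this)
    rw [← Finset.sum_mul, ← Finset.sum_div, ← ht, div_self h'.ne', one_mul]

theorem binaryTsallis_sq_mul_le {q : ℝ} (hq : 0 < q) (h : q ^ 2 - 5 * q + 3 ≤ 0) {m δ : ℝ}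
    (hm0 : 0 ≤ m) (hm1 : m ≤ 1) (hδ0 : 0 ≤ δ) (hδ1 : δ ≤ 1 / 4) :
    binaryTsallis q (m ^ 2 * δ) ≤ m * binaryTsallis q δ := by
  have hs : (2 * √δ) ^ 2 / 4 = δ := by rw [mul_pow, Real.sq_sqrt hδ0]; ring
  have hs1 : 2 * √δ ≤ 1 := by nlinarith [Real.sqrt_nonneg δ]
  have := (convexOn_binaryTsallis_sq hq h).2 (x := 2 * √δ) (y := 0) ⟨by positivity, hs1⟩
    ⟨le_rfl, by norm_num⟩ hm0 (sub_nonneg.2 hm1) (by ring)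
  have e : (m * (2 * √δ)) ^ 2 / 4 = m ^ 2 * δ := by rw [mul_pow, mul_div_assoc, hs]
  simpa [binaryTsallis_zero hq, hs, e] using this

theorem pos_and_bounds_of_mem {q : ℝ}
    (hq : q ∈ Icc ((5 - √13) / 2) 2 ∪ Icc 3 ((5 + √13) / 2)) :
    0 < q ∧ 0 ≤ (q - 2) * (q - 3) ∧ q ^ 2 - 5 * q + 3 ≤ 0 := by
  have h13 := Real.sq_sqrt (show (0 : ℝ) ≤ 13 by norm_num)
  have h3 : 3 ≤ √13 := Real.le_sqrt_of_sq_le (by norm_num)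
  have h4 : √13 ≤ 4 := Real.sqrt_le_iff.2 (by norm_num)
  rcases hq with ⟨h1, h2⟩ | ⟨h1, h2⟩
  · exact ⟨by linarith, by nlinarith, by nlinarith⟩
  · exact ⟨by linarith, by nlinarith, by nlinarith⟩

end GWV

/-! ### Entropy of pure states and supports of decompositions -/

namespace GWV

open Matrix in
theorem trace_mul_self_eq_sum_eigenvalues_sq {α : Type} [Fintype α] [DecidableEq α]
    {ρ : Matrix α α ℂ} (hρ : ρ.IsHermitian) :
    (ρ * ρ).trace = ((∑ i, hρ.eigenvalues i ^ 2 : ℝ) : ℂ) := by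
  conv_lhs => rw [hρ.spectral_theorem, ← map_mul, Unitary.conjStarAlgAut_apply, trace_mul_comm,
    ← mul_assoc]
  simp [pow_two]

/-- Missing eigenvalues are replaced by 0, which f does not see. -/
theorem exists_eigenvalue_pair {α : Type} [Fintype α] [DecidableEq α]
    {ρ : Matrix α α ℂ} (hρ : ρ.IsHermitian) (hr : ρ.rank ≤ 2) :
    ∃ x y : ℝ, ∀ f : ℝ → ℝ, f 0 = 0 → ∑ i, f (hρ.eigenvalues i) = f x + f y := by
  classical
  have hcard : (Finset.univ.filter fun i => hρ.eigenvalues i ≠ 0).card ≤ 2 := by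
    rwa [← Fintype.card_subtype, ← hρ.rank_eq_card_non_zero_eigs]
  have hsum : ∀ f : ℝ → ℝ, f 0 = 0 → ∑ i, f (hρ.eigenvalues i) =
      ∑ i ∈ Finset.univ.filter fun i => hρ.eigenvalues i ≠ 0, f (hρ.eigenvalues i) := by
    intro f hf
    refine (Finset.sum_subset (Finset.filter_subset _ _) fun i _ hi => ?_).symm
    have : hρ.eigenvalues i = 0 := by simpa using hi
    rw [this, hf]
  interval_cases h : (Finset.univ.filter fun i => hρ.eigenvalues i ≠ 0).card
  · exact ⟨0, 0, fun f hf => by rw [hsum f hf, Finset.card_eq_zero.1 h, hf]; simp⟩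
  · obtain ⟨i, hi⟩ := Finset.card_eq_one.1 h
    exact ⟨hρ.eigenvalues i, 0, fun f hf => by rw [hsum f hf, hi, hf]; simp⟩
  · obtain ⟨i, j, hij, hi⟩ := Finset.card_eq_two.1 h
    exact ⟨hρ.eigenvalues i, hρ.eigenvalues j, fun f hf => by
      rw [hsum f hf, hi, Finset.sum_pair hij]⟩

theorem sum_eigenvalues_eq_one {α : Type} [Fintype α] [DecidableEq α]
    {ρ : Matrix α α ℂ} (hρ : ρ.IsHermitian) (htr : ρ.trace = 1) :
    ∑ i, hρ.eigenvalues i = 1 := by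
  refine Complex.ofReal_eq_one.1 ?_
  rw [Complex.ofReal_sum, ← htr]
  exact hρ.trace_eq_sum_eigenvalues.symm

/-- The Tsallis entropy of a density matrix of rank at most two is determined by its purity. -/
theorem tsallisEntropy_eq_binaryTsallis {α : Type} [Fintype α] [DecidableEq α] {q δ : ℝ}
    (hq : 0 < q) {ρ : Matrix α α ℂ} (hρ : ρ.IsHermitian) (hr : ρ.rank ≤ 2) (htr : ρ.trace = 1)
    (hsq : (ρ * ρ).trace = ((1 - 2 * δ : ℝ) : ℂ)) :
    tsallisEntropy q hρ = binaryTsallis q δ := by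
  obtain ⟨x, y, h⟩ := exists_eigenvalue_pair hρ hr
  have h1 : x + y = 1 := by
    rw [← sum_eigenvalues_eq_one hρ htr]
    exact (h id rfl).symm
  have h2 : x ^ 2 + y ^ 2 = 1 - 2 * δ := by
    rw [trace_mul_self_eq_sum_eigenvalues_sq hρ] at hsq
    rw [← Complex.ofReal_inj.1 hsq]
    exact (h (fun t => t ^ 2) (by simp)).symm
  have hδ : δ = x * y := by
    have : (x + y) ^ 2 = 1 := by rw [h1, one_pow]
    nlinarith
  rw [hδ, ← pairEntropy_eq_binaryTsallis q h1, tsallisEntropy, pairEntropy,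
    h _ Real.negMulLog_zero, h (fun t => t ^ q) (Real.zero_rpow hq.ne')]

theorem marginal_eq_mul_conjTranspose {α β : Type} [Fintype β] (ψ : α × β → ℂ) :
    marginal ψ = Matrix.of (Function.curry ψ) * (Matrix.of (Function.curry ψ)).conjTranspose := by
  ext x y
  simp [marginal, projector, Matrix.mul_apply, Function.curry]

theorem trace_marginal {α β : Type} [Fintype α] [Fintype β] (ψ : α × β → ℂ) :
    (marginal ψ).trace = ((∑ x, ‖ψ x‖ ^ 2 : ℝ) : ℂ) := by
  simp [Matrix.trace, marginal, projector, Fintype.sum_prod_type, Complex.mul_conj']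

section
variable {α β : Type} [Fintype α] [DecidableEq α] [Fintype β]

open scoped ComplexOrder in
theorem eigenvalues_marginal_mem {ψ : α × β → ℂ} (hψ : ∑ x, ‖ψ x‖ ^ 2 = 1) (i : α) :
    (marginal_isHermitian ψ).eigenvalues i ∈ Set.Icc (0 : ℝ) 1 := by
  have hpos : ∀ i, 0 ≤ (marginal_isHermitian ψ).eigenvalues i :=
    Matrix.PosSemidef.eigenvalues_nonneg (A := marginal ψ) <| by
      rw [marginal_eq_mul_conjTranspose]
      exact Matrix.posSemidef_self_mul_conjTranspose _
  refine ⟨hpos i, ?_⟩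
  rw [← sum_eigenvalues_eq_one (marginal_isHermitian ψ) (by rw [trace_marginal, hψ]; simp)]
  exact Finset.single_le_sum (fun i _ => hpos i) (Finset.mem_univ i)

theorem tsallisPure_nonneg {q : ℝ} (hq : 0 < q) {ψ : α × β → ℂ} (hψ : ∑ x, ‖ψ x‖ ^ 2 = 1) :
    0 ≤ tsallisPure q ψ := by
  have hmem := eigenvalues_marginal_mem hψ
  have hsum := sum_eigenvalues_eq_one (marginal_isHermitian ψ) (by rw [trace_marginal, hψ]; simp)
  rw [tsallisPure, tsallisEntropy]
  split_ifs with h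
  · exact Finset.sum_nonneg fun i _ => Real.negMulLog_nonneg (hmem i).1 (hmem i).2
  · rw [← hsum, ← Finset.sum_sub_distrib, Finset.sum_div]
    refine Finset.sum_nonneg fun i _ => ?_
    rcases (hmem i).1.eq_or_lt with h0 | h0
    · simp [← h0, Real.zero_rpow hq.ne']
    rcases lt_or_gt_of_ne h with h1 | h1
    · refine div_nonneg_of_nonpos ?_ (by linarith)
      have := Real.rpow_le_rpow_of_exponent_ge h0 (hmem i).2 h1.le
      rw [Real.rpow_one] at this
      linarith
    · refine div_nonneg ?_ (by linarith)
      have := Real.rpow_le_rpow_of_exponent_ge h0 (hmem i).2 h1.le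
      rw [Real.rpow_one] at this
      linarith

/-- A crude bound, needed only to make the supremum defining the assistance bounded above. At q = 1
the division by zero makes the last term vanish. -/
theorem tsallisPure_le {q : ℝ} (hq : 0 < q) {ψ : α × β → ℂ} (hψ : ∑ x, ‖ψ x‖ ^ 2 = 1) :
    tsallisPure q ψ ≤ Fintype.card α + (1 + Fintype.card α) / |q - 1| := by
  have hmem := eigenvalues_marginal_mem hψ
  rw [tsallisPure, tsallisEntropy]
  split_ifs with h
  · rw [h, sub_self, abs_zero, div_zero, add_zero]
    refine (Finset.sum_le_card_nsmul _ _ 1 fun i _ => ?_).trans (by simp)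
    rcases (hmem i).1.eq_or_lt with h0 | h0
    · simp [← h0]
    · have := (abs_lt.1 (Real.abs_log_mul_self_lt _ h0 (hmem i).2)).1
      rw [Real.negMulLog]
      linarith
  · have h1 : ∑ i, (marginal_isHermitian ψ).eigenvalues i ^ q ≤ Fintype.card α :=
      (Finset.sum_le_card_nsmul _ _ 1 fun i _ =>
        Real.rpow_le_one (hmem i).1 (hmem i).2 hq.le).trans (by simp)
    have h2 : 0 ≤ ∑ i, (marginal_isHermitian ψ).eigenvalues i ^ q :=
      Finset.sum_nonneg fun i _ => Real.rpow_nonneg (hmem i).1 q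
    refine (le_abs_self _).trans ?_
    rw [abs_div]
    have h3 : |1 - ∑ i, (marginal_isHermitian ψ).eigenvalues i ^ q| ≤ 1 + Fintype.card α :=
      abs_le.2 ⟨by linarith, by linarith⟩
    have := div_le_div_of_nonneg_right h3 (abs_nonneg (q - 1))
    have : (0 : ℝ) ≤ Fintype.card α := by positivity
    linarith

theorem tsallisAssistance_nonneg {q : ℝ} (hq : 0 < q) (ρ : Matrix (α × β) (α × β) ℂ) :
    0 ≤ tsallisAssistance q ρ := by
  refine Real.sSup_nonneg ?_
  rintro t ⟨N, w, ψ, h, rfl⟩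
  exact Finset.sum_nonneg fun i _ => mul_nonneg (h.nonneg i) (tsallisPure_nonneg hq (h.normalized i))

theorem sum_tsallisPure_le_tsallisAssistance {q : ℝ} (hq : 0 < q) {ρ : Matrix (α × β) (α × β) ℂ}
    {κ : Type*} [Fintype κ] (w : κ → ℝ) (ψ : κ → α × β → ℂ) (hw : ∀ i, 0 ≤ w i)
    (hw1 : ∑ i, w i = 1) (hψ : ∀ i, ∑ x, ‖ψ i x‖ ^ 2 = 1)
    (hρ : ρ = ∑ i, (w i : ℂ) • projector (ψ i)) :
    ∑ i, w i * tsallisPure q (ψ i) ≤ tsallisAssistance q ρ := by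
  refine le_csSup ⟨Fintype.card α + (1 + Fintype.card α) / |q - 1|, ?_⟩ ?_
  · rintro t ⟨N, w, ψ, h, rfl⟩
    calc ∑ i, w i * tsallisPure q (ψ i)
        ≤ ∑ i, w i * (Fintype.card α + (1 + Fintype.card α) / |q - 1|) :=
          Finset.sum_le_sum fun i _ =>
            mul_le_mul_of_nonneg_left (tsallisPure_le hq (h.normalized i)) (h.nonneg i)
      _ = _ := by rw [← Finset.sum_mul, h.sum_eq_one, one_mul]
  · let e := (Fintype.equivFin κ).symm
    refine ⟨Fintype.card κ, w ∘ e, ψ ∘ e, ⟨fun i => hw _, ?_, fun i => hψ _, ?_⟩, ?_⟩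
    · rw [← hw1]; exact e.sum_comp w
    · rw [hρ]; exact (e.sum_comp fun i => (w i : ℂ) • projector (ψ i)).symm
    · exact (e.sum_comp fun i => w i * tsallisPure q (ψ i)).symm

end

/-- The left side depends only on the matrix, so ∑ c_j |f(u_j)|² is the same for all its
decompositions. -/
theorem sum_projector_mul_dual {ι κ : Type} [Fintype ι] [DecidableEq ι] [Fintype κ]
    (c : κ → ℝ) (u : κ → ι → ℂ) (f : Module.Dual ℂ (ι → ℂ)) :
    ∑ x, ∑ y, (∑ j, (c j : ℂ) • projector (u j)) x y *
      (f (Pi.single x 1) * conj (f (Pi.single y 1))) = ((∑ j, c j * ‖f (u j)‖ ^ 2 : ℝ) : ℂ) := by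
  have hf : ∀ v, f v = ∑ x, v x * f (Pi.single x 1) := fun v => by
    conv_lhs => rw [pi_eq_sum_univ' v, map_sum]
    simp only [map_smul, smul_eq_mul, Pi.single]
  have key : ∀ v, ((‖f v‖ ^ 2 : ℝ) : ℂ) =
      ∑ x, ∑ y, projector v x y * (f (Pi.single x 1) * conj (f (Pi.single y 1))) := fun v => by
    rw [Complex.ofReal_pow, ← Complex.mul_conj', hf v, map_sum, Finset.sum_mul_sum]
    refine Finset.sum_congr rfl fun x _ => Finset.sum_congr rfl fun y _ => ?_
    rw [projector, map_mul]
    ring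
  rw [Complex.ofReal_sum]
  simp_rw [Complex.ofReal_mul, key, Matrix.sum_apply, Finset.sum_mul, Matrix.smul_apply,
    smul_eq_mul, Finset.mul_sum, mul_assoc]
  rw [Finset.sum_comm]
  conv_rhs => rw [Finset.sum_comm]
  rw [Finset.sum_comm]
  exact Finset.sum_congr rfl fun x _ => Finset.sum_comm

/-- The vectors of a decomposition of a positive matrix lie in every subspace that contains the
vectors of another decomposition of it. -/
theorem mem_of_sum_projector_eq {ι κ κ' : Type} [Fintype ι] [Fintype κ] [Fintype κ'] {w : κ' → ℝ}
    (hw : ∀ i, 0 ≤ w i) {ψ : κ' → ι → ℂ} {c : κ → ℝ} {u : κ → ι → ℂ}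
    (h : ∑ j, (c j : ℂ) • projector (u j) = ∑ i, (w i : ℂ) • projector (ψ i))
    (K : Submodule ℂ (ι → ℂ)) (hu : ∀ j, u j ∈ K) {i : κ'} (hi : w i ≠ 0) : ψ i ∈ K := by
  classical
  by_contra hmem
  obtain ⟨f, hf, hK⟩ := Submodule.exists_le_ker_of_notMem hmem
  have h1 := sum_projector_mul_dual c u f
  have h0 : ∑ j, c j * ‖f (u j)‖ ^ 2 = 0 :=
    Finset.sum_eq_zero fun j _ => by rw [LinearMap.mem_ker.1 (hK (hu j))]; simp
  rw [h, sum_projector_mul_dual w ψ f, Complex.ofReal_inj, h0] at h1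
  have := (Finset.sum_eq_zero_iff_of_nonneg
    fun i _ => mul_nonneg (hw i) (sq_nonneg ‖f (ψ i)‖)).1 h1 i (Finset.mem_univ i)
  simp [hi, hf] at this

/-! ### Two-party vectors spanned by the shared W-vector and the vacuum -/

/-- The squared norm of the generalized `W`-class vector with amplitudes `a`. -/
noncomputable def wWeight {ι : Type} [Fintype ι] {d : ℕ} [NeZero d]
    (a : ι → Fin d → ℂ) : ℝ := ∑ s : ι, ∑ i ∈ Finset.univ.erase (0 : Fin d), ‖a s i‖ ^ 2

theorem wWeight_nonneg {ι : Type} [Fintype ι] {d : ℕ} [NeZero d] (a : ι → Fin d → ℂ) : 0 ≤ wWeight a :=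
  Finset.sum_nonneg fun _ _ => Finset.sum_nonneg fun _ _ => sq_nonneg _

/-- The vacuum vector. -/
noncomputable def vacuum {ι : Type} [Fintype ι] {d : ℕ} [NeZero d] (x : ι → Fin d) : ℂ := if x = 0 then 1 else 0

theorem vacuum_zero {ι : Type} [Fintype ι] {d : ℕ} [NeZero d] :
    vacuum (0 : ι → Fin d) = 1 := if_pos rfl

section
variable {ι κ : Type} [Fintype ι] [DecidableEq ι] [Fintype κ] [DecidableEq κ] {d : ℕ} [NeZero d]

/-- The unnormalised generalized `W`-class vector on an arbitrary set of qudits. -/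
noncomputable def wVec (a : ι → Fin d → ℂ) (x : ι → Fin d) : ℂ :=
  ∑ s : ι, ∑ i ∈ Finset.univ.erase (0 : Fin d), if x = Pi.single s i then a s i else 0

/-- The vector `α (|W⟩|0⟩ + |0⟩|W⟩) + β |0⟩|0⟩` of two parties. -/
noncomputable def pairVec (α β : ℂ) (a : ι → Fin d → ℂ) (b : κ → Fin d → ℂ)
    (z : (ι → Fin d) × (κ → Fin d)) : ℂ :=
  (α * wVec a z.1 + β * vacuum z.1) * vacuum z.2 + α * vacuum z.1 * wVec b z.2

theorem wVec_zero (a : ι → Fin d → ℂ) : wVec a 0 = 0 := by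
  refine Finset.sum_eq_zero fun s _ => Finset.sum_eq_zero fun i hi => if_neg fun h => ?_
  exact Finset.ne_of_mem_erase hi (Pi.single_eq_zero_iff.1 h.symm)

theorem sum_norm_sq_sum_ite {X K : Type*} [Fintype X] [DecidableEq X] (s : Finset K) (f : K → X)
    (hf : Set.InjOn f s) (c : K → ℂ) :
    ∑ x, ‖∑ k ∈ s, if x = f k then c k else 0‖ ^ 2 = ∑ k ∈ s, ‖c k‖ ^ 2 := by
  have : ∀ x, ‖∑ k ∈ s, if x = f k then c k else 0‖ ^ 2 =
      ∑ k ∈ s, if x = f k then ‖c k‖ ^ 2 else 0 := fun x => by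
    by_cases hx : ∃ k ∈ s, x = f k
    · obtain ⟨k, hk, rfl⟩ := hx
      have hne : ∀ l ∈ s, l ≠ k → ¬ f k = f l := fun l hl hlk h => hlk (hf hl hk h.symm)
      rw [Finset.sum_eq_single_of_mem k hk fun l hl hlk => if_neg (hne l hl hlk),
        Finset.sum_eq_single_of_mem k hk fun l hl hlk => if_neg (hne l hl hlk)]
      simp
    · rw [Finset.sum_eq_zero fun k hk => if_neg fun h => hx ⟨k, hk, h⟩,
        Finset.sum_eq_zero fun k hk => if_neg fun h => hx ⟨k, hk, h⟩]
      simp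
  simp_rw [this]
  rw [Finset.sum_comm]
  simp

theorem sum_norm_sq_wVec (a : ι → Fin d → ℂ) : ∑ x, ‖wVec a x‖ ^ 2 = wWeight a := by
  have := sum_norm_sq_sum_ite (X := ι → Fin d) (Finset.univ ×ˢ Finset.univ.erase (0 : Fin d))
    (fun k : ι × Fin d => Pi.single k.1 k.2) (fun k hk l hl h => ?_) (fun k => a k.1 k.2)
  · simp only [Finset.sum_product] at this
    exact this
  · have hk' : k.2 ≠ 0 := by simpa using hk
    have h1 := congrFun h k.1
    simp only [Pi.single_eq_same, Pi.single_apply] at h1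
    split_ifs at h1 with h2
    · exact Prod.ext h2 h1
    · exact absurd h1 hk'

/-- The vacuum is a unit vector orthogonal to every W-vector; all partial traces below reduce to
this. -/
theorem sum_vacuum_mul_conj (b : κ → Fin d → ℂ) (r s r' s' : ℂ) :
    ∑ y, (r * vacuum y + s * wVec b y) * conj (r' * vacuum y + s' * wVec b y) =
      r * conj r' + s * conj s' * (wWeight b : ℂ) := by
  have h : ∀ y : κ → Fin d, (r * vacuum y + s * wVec b y) * conj (r' * vacuum y + s' * wVec b y) =
      (if y = 0 then r * conj r' else 0) + s * conj s' * ((‖wVec b y‖ ^ 2 : ℝ) : ℂ) := fun y => by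
    rw [Complex.ofReal_pow, ← Complex.mul_conj', vacuum]
    split_ifs with h
    · simp [h, wVec_zero]
    · simp; ring
  simp_rw [h]
  rw [Finset.sum_add_distrib, ← Finset.mul_sum, ← Complex.ofReal_sum, sum_norm_sq_wVec]
  simp

theorem marginal_pairVec (α β : ℂ) (a : ι → Fin d → ℂ) (b : κ → Fin d → ℂ) :
    marginal (pairVec α β a b) =
      Matrix.vecMulVec (fun x => α * wVec a x + β * vacuum x)
        (star fun x => α * wVec a x + β * vacuum x) +
      ((‖α‖ ^ 2 * wWeight b : ℝ) : ℂ) • Matrix.vecMulVec vacuum (star vacuum) := by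
  ext x x'
  have := sum_vacuum_mul_conj b (α * wVec a x + β * vacuum x) (α * vacuum x)
    (α * wVec a x' + β * vacuum x') (α * vacuum x')
  simp only [marginal, projector, pairVec, this, Matrix.add_apply, Matrix.smul_apply,
    Matrix.vecMulVec_apply, Pi.star_apply, RCLike.star_def, smul_eq_mul]
  push_cast
  rw [← Complex.mul_conj', map_mul]
  ring

theorem dotProduct_star_self (α β : ℂ) (a : ι → Fin d → ℂ) :
    (fun x => α * wVec a x + β * vacuum x) ⬝ᵥ (star fun x => α * wVec a x + β * vacuum x) =
      ((‖α‖ ^ 2 * wWeight a + ‖β‖ ^ 2 : ℝ) : ℂ) := by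
  have := sum_vacuum_mul_conj a β α β α
  simp only [dotProduct, Pi.star_apply, RCLike.star_def, add_comm (α * _)]
  rw [this]
  push_cast
  rw [← Complex.mul_conj', ← Complex.mul_conj']
  ring

theorem dotProduct_vacuum (v : (ι → Fin d) → ℂ) : v ⬝ᵥ (star vacuum) = v 0 := by
  simp [dotProduct, vacuum]

theorem vacuum_dotProduct (v : (ι → Fin d) → ℂ) : vacuum ⬝ᵥ v = v 0 := by
  simp [dotProduct, vacuum]

theorem sum_norm_sq_pairVec (α β : ℂ) (a : ι → Fin d → ℂ) (b : κ → Fin d → ℂ) :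
    ∑ z, ‖pairVec α β a b z‖ ^ 2 = ‖α‖ ^ 2 * (wWeight a + wWeight b) + ‖β‖ ^ 2 := by
  have := trace_marginal (pairVec α β a b)
  rw [marginal_pairVec, Matrix.trace_add, Matrix.trace_smul, Matrix.trace_vecMulVec,
    Matrix.trace_vecMulVec, dotProduct_star_self, dotProduct_vacuum, vacuum_zero, smul_eq_mul,
    mul_one, ← Complex.ofReal_add, Complex.ofReal_inj] at this
  rw [← this]
  ring

theorem trace_marginal_pairVec_mul_self (α β : ℂ) (a : ι → Fin d → ℂ) (b : κ → Fin d → ℂ) :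
    (marginal (pairVec α β a b) * marginal (pairVec α β a b)).trace =
      (((‖α‖ ^ 2 * wWeight a + ‖β‖ ^ 2) ^ 2 + 2 * (‖α‖ ^ 2 * wWeight b) * ‖β‖ ^ 2 +
        (‖α‖ ^ 2 * wWeight b) ^ 2 : ℝ) : ℂ) := by
  rw [marginal_pairVec]
  have hβ : ((‖β‖ : ℂ)) ^ 2 = β * conj β := (Complex.mul_conj' β).symm
  simp only [mul_add, add_mul, Matrix.smul_mul, Matrix.mul_smul, Matrix.vecMulVec_mul_vecMulVec,
    Matrix.trace_add, Matrix.trace_smul, Matrix.trace_vecMulVec, dotProduct_smul,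
    dotProduct_comm (star _) _, dotProduct_star_self, dotProduct_vacuum, vacuum_dotProduct]
  simp only [wVec_zero, vacuum_zero, Pi.star_apply, smul_eq_mul]
  push_cast
  simp only [hβ]
  simp
  ring

theorem rank_marginal_pairVec_le (α β : ℂ) (a : ι → Fin d → ℂ) (b : κ → Fin d → ℂ) :
    (marginal (pairVec α β a b)).rank ≤ 2 := by
  set V : ℝ := ‖α‖ ^ 2 * wWeight b with hV
  have h : marginal (pairVec α β a b) =
      (Matrix.of fun x => ![α * wVec a x + β * vacuum x, vacuum x] : Matrix _ (Fin 2) ℂ) *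
      (Matrix.of ![fun x => conj (α * wVec a x + β * vacuum x), fun x => (V : ℂ) * conj (vacuum x)] :
        Matrix (Fin 2) _ ℂ) := by
    rw [marginal_pairVec, ← hV]
    ext x y
    simp [Matrix.mul_apply, Fin.sum_univ_two, Matrix.vecMulVec_apply]
    ring
  rw [h]
  exact (Matrix.rank_mul_le_left _ _).trans (Matrix.rank_le_card_width _)

theorem tsallisPure_pairVec {q : ℝ} (hq : 0 < q) (α β : ℂ) (a : ι → Fin d → ℂ) (b : κ → Fin d → ℂ)
    (h : ‖α‖ ^ 2 * (wWeight a + wWeight b) + ‖β‖ ^ 2 = 1) :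
    tsallisPure q (pairVec α β a b) = binaryTsallis q (‖α‖ ^ 4 * wWeight a * wWeight b) := by
  refine tsallisEntropy_eq_binaryTsallis hq _ (rank_marginal_pairVec_le α β a b) ?_ ?_
  · rw [trace_marginal, sum_norm_sq_pairVec, h, Complex.ofReal_one]
  -- Eliminating |β|² by normalisation turns the purity into 1 - 2|α|⁴AB.
  · rw [trace_marginal_pairVec_mul_self, Complex.ofReal_inj,
      show ‖β‖ ^ 2 = 1 - ‖α‖ ^ 2 * (wWeight a + wWeight b) by linarith]
    ring

end

/-! ### Reduced density matrices of GWV states -/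

section
variable {n d : ℕ} {P R : Finset (Fin n)}

theorem sum_eq_sum_parts {M : Type*} [AddCommMonoid M] (hPR : Disjoint P R) (F : Fin n → M) :
    ∑ s, F s = ∑ s : P, F s + ∑ s : R, F s + ∑ s : {i : Fin n // i ∉ P ∧ i ∉ R}, F s := by
  rw [Finset.sum_coe_sort P F, Finset.sum_coe_sort R F,
    ← Finset.sum_subtype (Finset.univ.filter fun i => i ∉ P ∧ i ∉ R) (by simp) F,
    ← Finset.sum_union hPR, ← Finset.sum_filter_add_sum_filter_not Finset.univ (· ∈ P ∪ R) F]
  congr 1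
  · exact Finset.sum_congr (by ext; simp) fun _ _ => rfl
  · simp [not_or]

theorem glue_eq_iff (hPR : Disjoint P R) {x : P → Fin d} {y : R → Fin d}
    {z : {i : Fin n // i ∉ P ∧ i ∉ R} → Fin d} {v : Fin n → Fin d} :
    glue x y z = v ↔ x = (fun i : P => v i) ∧ y = (fun i : R => v i) ∧
      z = fun i : {i : Fin n // i ∉ P ∧ i ∉ R} => v i := by
  constructor
  · rintro rfl
    refine ⟨?_, ?_, ?_⟩ <;> ext i
    · simp [glue]
    · simp [glue, Finset.disjoint_right.1 hPR i.2]
    · simp [glue, i.2.1, i.2.2]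
  · rintro ⟨rfl, rfl, rfl⟩
    ext i
    simp only [glue]
    split_ifs <;> rfl

variable [NeZero d]

theorem restrict_single {p : Fin n → Prop} [DecidablePred p] (s : Subtype p) (i : Fin d) :
    (fun j : Subtype p => (Pi.single (s : Fin n) i : Fin n → Fin d) j) = Pi.single s i := by
  ext j
  simp [Pi.single_apply, Subtype.ext_iff]

theorem restrict_single_of_not {p : Fin n → Prop} {s : Fin n} (hs : ¬ p s) (i : Fin d) :
    (fun j : Subtype p => (Pi.single s i : Fin n → Fin d) j) = 0 := by
  ext j
  rw [Pi.single_eq_of_ne (fun h : (j : Fin n) = s => hs (h ▸ j.2))]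
  rfl

theorem vacuum_glue (hPR : Disjoint P R) (x : P → Fin d) (y : R → Fin d)
    (z : {i : Fin n // i ∉ P ∧ i ∉ R} → Fin d) :
    vacuum (glue x y z) = vacuum x * vacuum y * vacuum z := by
  have : glue x y z = 0 ↔ x = 0 ∧ y = 0 ∧ z = 0 := glue_eq_iff hPR
  simp only [vacuum, this]
  split_ifs <;> simp_all

/-- The single excitation sits in exactly one of the three parts. -/
theorem wVec_glue (hPR : Disjoint P R) (a : Fin n → Fin d → ℂ) (x : P → Fin d) (y : R → Fin d)
    (z : {i : Fin n // i ∉ P ∧ i ∉ R} → Fin d) :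
    wVec a (glue x y z) = wVec (fun s : P => a s) x * vacuum y * vacuum z +
      vacuum x * wVec (fun s : R => a s) y * vacuum z +
      vacuum x * vacuum y * wVec (fun s : {i : Fin n // i ∉ P ∧ i ∉ R} => a s) z := by
  rw [wVec, sum_eq_sum_parts hPR]
  simp only [wVec, Finset.sum_mul, Finset.mul_sum]
  refine congrArg₂ _ (congrArg₂ _ ?_ ?_) ?_ <;>
  refine Finset.sum_congr rfl fun s _ => Finset.sum_congr rfl fun i _ => ?_
  · have h : glue x y z = Pi.single (s : Fin n) i ↔ x = Pi.single s i ∧ y = 0 ∧ z = 0 := by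
      rw [glue_eq_iff hPR, restrict_single s, restrict_single_of_not
        (Finset.disjoint_left.1 hPR s.2), restrict_single_of_not (fun h => h.1 s.2)]
    simp only [vacuum, h]
    split_ifs <;> simp_all
  · have h : glue x y z = Pi.single (s : Fin n) i ↔ x = 0 ∧ y = Pi.single s i ∧ z = 0 := by
      rw [glue_eq_iff hPR, restrict_single s, restrict_single_of_not
        (Finset.disjoint_right.1 hPR s.2), restrict_single_of_not (fun h => h.2 s.2)]
    simp only [vacuum, h]
    split_ifs <;> simp_all
  · have h : glue x y z = Pi.single (s : Fin n) i ↔ x = 0 ∧ y = 0 ∧ z = Pi.single s i := by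
      rw [glue_eq_iff hPR, restrict_single s, restrict_single_of_not s.2.1,
        restrict_single_of_not s.2.2]
    simp only [vacuum, h]
    split_ifs <;> simp_all

theorem wWeight_eq_add (hPR : Disjoint P R) (a : Fin n → Fin d → ℂ) :
    wWeight a = wWeight (fun s : P => a s) + wWeight (fun s : R => a s) +
      wWeight (fun s : {i : Fin n // i ∉ P ∧ i ∉ R} => a s) :=
  sum_eq_sum_parts hPR _

/-- The reduced density matrices of a generalized `W`-class state superposed with the vacuum. -/
theorem reduced_gwv (hPR : Disjoint P R) {p : ℝ} (hp : 0 ≤ p) (a : Fin n → Fin d → ℂ) :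
    reduced (gwv p a) P R =
      projector (pairVec (√p : ℂ) (√(1 - p) : ℂ) (fun s : P => a s) (fun s : R => a s)) +
      ((p * (wWeight a - wWeight (fun s : P => a s) - wWeight (fun s : R => a s)) : ℝ) : ℂ) •
        projector (pairVec 0 1 (fun s : P => a s) (fun s : R => a s)) := by
  ext u v
  -- The environment is either in its vacuum or in its W-vector. These are orthogonal, and an
  -- excited environment leaves the vacuum on P and R.
  have hψ : ∀ (u : (P → Fin d) × (R → Fin d)) (z : {i : Fin n // i ∉ P ∧ i ∉ R} → Fin d),
      gwv p a (glue u.1 u.2 z) =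
      pairVec (√p : ℂ) (√(1 - p) : ℂ) (fun s : P => a s) (fun s : R => a s) u * vacuum z +
      (√p * pairVec 0 1 (fun s : P => a s) (fun s : R => a s) u) *
        wVec (fun s : {i : Fin n // i ∉ P ∧ i ∉ R} => a s) z := fun u z => by
    have h1 : gwv p a (glue u.1 u.2 z) = √p * wVec a (glue u.1 u.2 z) +
      √(1 - p) * vacuum (glue u.1 u.2 z) := rfl
    rw [h1, wVec_glue hPR, vacuum_glue hPR]
    simp only [pairVec]
    ring
  have hsq : (√p : ℂ) * √p = p := by rw [← Complex.ofReal_mul, Real.mul_self_sqrt hp]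
  simp only [reduced, hψ, sum_vacuum_mul_conj]
  rw [wWeight_eq_add hPR a]
  simp only [Matrix.add_apply, Matrix.smul_apply, projector, map_mul, Complex.conj_ofReal,
    smul_eq_mul]
  push_cast
  rw [← hsq]
  ring

end

/-! ### Transferring a decomposition to a smaller party -/

section
variable {ι κ : Type} [Fintype ι] [DecidableEq ι] [Fintype κ] [DecidableEq κ] {d : ℕ} [NeZero d]

theorem pairVec_eq (α β : ℂ) (a : ι → Fin d → ℂ) (b : κ → Fin d → ℂ) :
    pairVec α β a b = α • pairVec 1 0 a b + β • pairVec 0 1 a b := by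
  ext z
  simp only [pairVec, Pi.add_apply, Pi.smul_apply, smul_eq_mul]
  ring

theorem pairVec_smul (c α β : ℂ) (a : ι → Fin d → ℂ) (b : κ → Fin d → ℂ) :
    pairVec (c * α) (c * β) a b = c • pairVec α β a b := by
  ext z
  simp only [pairVec, Pi.smul_apply, smul_eq_mul]
  ring

theorem projector_smul {ι : Type} (c : ℂ) (ψ : ι → ℂ) :
    projector (c • ψ) = ((‖c‖ ^ 2 : ℝ) : ℂ) • projector ψ := by
  ext x y
  simp only [projector, Pi.smul_apply, Matrix.smul_apply, smul_eq_mul, map_mul]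
  push_cast
  rw [← Complex.mul_conj']
  ring

theorem sum_projector_pairVec {N : ℕ} (w : Fin N → ℝ) (α β : Fin N → ℂ) (a : ι → Fin d → ℂ)
    (b : κ → Fin d → ℂ) (u v : (ι → Fin d) × (κ → Fin d)) :
    (∑ i, (w i : ℂ) • projector (pairVec (α i) (β i) a b)) u v =
      (∑ i, w i * (α i * conj (α i))) * (pairVec 1 0 a b u * conj (pairVec 1 0 a b v)) +
      (∑ i, w i * (α i * conj (β i))) * (pairVec 1 0 a b u * conj (pairVec 0 1 a b v)) +
      (∑ i, w i * (β i * conj (α i))) * (pairVec 0 1 a b u * conj (pairVec 1 0 a b v)) +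
      (∑ i, w i * (β i * conj (β i))) * (pairVec 0 1 a b u * conj (pairVec 0 1 a b v)) := by
  simp only [Finset.sum_mul, ← Finset.sum_add_distrib, Matrix.sum_apply, Matrix.smul_apply,
    projector, smul_eq_mul]
  refine Finset.sum_congr rfl fun i _ => ?_
  rw [pairVec_eq (α i) (β i)]
  simp only [Pi.add_apply, Pi.smul_apply, smul_eq_mul, map_add, map_mul]
  ring

theorem exists_normalized_pairVec {q : ℝ} (hq : 0 < q) (hq' : q ^ 2 - 5 * q + 3 ≤ 0) (α β : ℂ)
    (a : ι → Fin d → ℂ) (b : κ → Fin d → ℂ) {m : ℝ}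
    (hm : ‖α‖ ^ 2 * (wWeight a + wWeight b) + ‖β‖ ^ 2 = m) (hm1 : m ≤ 1) :
    ∃ ψ : (ι → Fin d) × (κ → Fin d) → ℂ, ∑ z, ‖ψ z‖ ^ 2 = 1 ∧
      (m : ℂ) • projector ψ = projector (pairVec α β a b) ∧
      binaryTsallis q (‖α‖ ^ 4 * wWeight a * wWeight b) ≤ m * tsallisPure q ψ := by
  have ha := wWeight_nonneg a
  have hb := wWeight_nonneg b
  have hm0 : 0 ≤ m := by rw [← hm]; positivity
  rcases hm0.eq_or_lt with h | h
  · have hzero : pairVec α β a b = 0 := by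
      ext z
      have := sum_norm_sq_pairVec α β a b
      rw [hm, ← h] at this
      simpa using (Finset.sum_eq_zero_iff_of_nonneg fun _ _ => sq_nonneg _).1 this z
        (Finset.mem_univ z)
    -- For m = 0 any unit vector serves, since its weight is zero; the vacuum is one.
    refine ⟨pairVec 0 1 a b, by rw [sum_norm_sq_pairVec]; simp, ?_, ?_⟩
    · rw [hzero, ← h]
      ext x y
      simp [projector]
    · have h1 : ‖α‖ ^ 2 * wWeight a = 0 := by
        have : 0 ≤ ‖α‖ ^ 2 * wWeight a := by positivity
        have : 0 ≤ ‖α‖ ^ 2 * wWeight b := by positivity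
        nlinarith [sq_nonneg ‖β‖]
      have : ‖α‖ ^ 4 * wWeight a * wWeight b = 0 := by
        calc _ = ‖α‖ ^ 2 * wWeight a * (‖α‖ ^ 2 * wWeight b) := by ring
          _ = 0 := by rw [h1, zero_mul]
      rw [this, ← h, binaryTsallis_zero hq, zero_mul]
  · have hs := Real.sqrt_pos.2 h
    have hsq := Real.sq_sqrt h.le
    have hnorm : ‖((√m)⁻¹ : ℂ)‖ ^ 2 = m⁻¹ := by
      rw [norm_inv, Complex.norm_real, Real.norm_of_nonneg hs.le, inv_pow, hsq]
    have hα : ‖((√m)⁻¹ : ℂ) * α‖ ^ 2 = ‖α‖ ^ 2 / m := by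
      rw [norm_mul, mul_pow, hnorm]; ring
    have hβ : ‖((√m)⁻¹ : ℂ) * β‖ ^ 2 = ‖β‖ ^ 2 / m := by
      rw [norm_mul, mul_pow, hnorm]; ring
    have hunit : ‖((√m)⁻¹ : ℂ) * α‖ ^ 2 * (wWeight a + wWeight b) + ‖((√m)⁻¹ : ℂ) * β‖ ^ 2 = 1 := by
      rw [hα, hβ]
      field_simp
      linarith
    refine ⟨pairVec ((√m : ℂ)⁻¹ * α) ((√m : ℂ)⁻¹ * β) a b, by rw [sum_norm_sq_pairVec, hunit], ?_, ?_⟩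
    · rw [pairVec_smul, projector_smul, hnorm, smul_smul, ← Complex.ofReal_mul,
        mul_inv_cancel₀ h.ne', Complex.ofReal_one, one_smul]
    · rw [tsallisPure_pairVec hq _ _ a b hunit]
      have e4 : ‖((√m)⁻¹ : ℂ) * α‖ ^ 4 = ‖α‖ ^ 4 / m ^ 2 := by
        calc _ = (‖((√m)⁻¹ : ℂ) * α‖ ^ 2) ^ 2 := by ring
          _ = _ := by rw [hα]; ring
      have hle : ‖((√m)⁻¹ : ℂ) * α‖ ^ 4 * wWeight a * wWeight b ≤ 1 / 4 := by
        have h1 : ‖((√m)⁻¹ : ℂ) * α‖ ^ 2 * (wWeight a + wWeight b) ≤ 1 := by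
          linarith [sq_nonneg ‖((√m)⁻¹ : ℂ) * β‖]
        nlinarith [sq_nonneg (‖((√m)⁻¹ : ℂ) * α‖ ^ 2 * (wWeight a - wWeight b)),
          show 0 ≤ ‖((√m)⁻¹ : ℂ) * α‖ ^ 2 * (wWeight a + wWeight b) by positivity]
      refine le_trans (le_of_eq ?_) (binaryTsallis_sq_mul_le hq hq' hm0 hm1 (by positivity) hle)
      rw [e4]
      congr 1
      field_simp

theorem exists_coeff_of_projector_eq {N : ℕ} {w : Fin N → ℝ} (hw : ∀ i, 0 ≤ w i)
    {a : ι → Fin d → ℂ} {b : κ → Fin d → ℂ} {ψ : Fin N → (ι → Fin d) × (κ → Fin d) → ℂ} {α β : ℂ}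
    {e : ℝ} (h : projector (pairVec α β a b) + (e : ℂ) • projector (pairVec 0 1 a b) =
      ∑ i, (w i : ℂ) • projector (ψ i)) {i : Fin N} (hi : w i ≠ 0) :
    ∃ α' β' : ℂ, ψ i = pairVec α' β' a b := by
  have hmem := mem_of_sum_projector_eq hw (c := ![1, e])
    (u := ![pairVec α β a b, pairVec 0 1 a b]) (by simpa [Fin.sum_univ_two] using h)
    (Submodule.span ℂ {pairVec 1 0 a b, pairVec 0 1 a b}) (fun j => ?_) hi
  · obtain ⟨α', β', h'⟩ := Submodule.mem_span_pair.1 hmem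
    exact ⟨α', β', by rw [pairVec_eq, h']⟩
  · rw [Submodule.mem_span_pair]
    fin_cases j
    · exact ⟨α, β, (pairVec_eq α β a b).symm⟩
    · exact ⟨0, 1, by simp⟩

/-- Since the W-part on the first party is nonzero, the entries at (x, 0) and (0, 0) recover the
second moments of the coefficients. These moments no longer mention the second party, so they can be
reused for another one. -/
theorem sum_coeff_of_projector_eq {N : ℕ} {w : Fin N → ℝ} {α' β' : Fin N → ℂ}
    {a : ι → Fin d → ℂ} {b : κ → Fin d → ℂ} {α β : ℂ} {e : ℝ} (ha : wWeight a ≠ 0)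
    (h : projector (pairVec α β a b) + (e : ℂ) • projector (pairVec 0 1 a b) =
      ∑ i, (w i : ℂ) • projector (pairVec (α' i) (β' i) a b)) :
    ∑ i, w i * (α' i * conj (α' i)) = α * conj α ∧
    ∑ i, w i * (α' i * conj (β' i)) = α * conj β ∧
    ∑ i, w i * (β' i * conj (α' i)) = β * conj α ∧
    ∑ i, w i * (β' i * conj (β' i)) = β * conj β + e := by
  obtain ⟨x, hx⟩ : ∃ x, wVec a x ≠ 0 := by
    by_contra! hcon
    refine ha ?_
    rw [← sum_norm_sq_wVec]
    simp [hcon]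
  have hx0 : x ≠ 0 := fun h0 => hx (by rw [h0, wVec_zero])
  have hv : vacuum x = 0 := if_neg hx0
  have e1 : ∀ α β : ℂ, pairVec α β a b (x, 0) = α * wVec a x := fun α β => by
    simp [pairVec, hv, wVec_zero, vacuum_zero]
  have e2 : ∀ α β : ℂ, pairVec α β a b (0, 0) = β := fun α β => by
    simp [pairVec, wVec_zero, vacuum_zero]
  have hent : ∀ u v, _ := fun u v => congrFun (congrFun h u) v
  simp only [sum_projector_pairVec, Matrix.add_apply, Matrix.smul_apply, projector,
    smul_eq_mul] at hent
  have hcx : conj (wVec a x) ≠ 0 := (map_ne_zero _).2 hx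
  refine ⟨?_, ?_, ?_, ?_⟩
  · have := hent (x, 0) (x, 0)
    simp only [e1, map_mul, map_zero, zero_mul, mul_zero, one_mul, add_zero] at this
    exact mul_right_cancel₀ (mul_ne_zero hx hcx) (by linear_combination -this)
  · have := hent (x, 0) (0, 0)
    simp only [e1, e2, map_zero, map_one, zero_mul, mul_zero, one_mul, mul_one, add_zero,
      zero_add] at this
    exact mul_right_cancel₀ hx (by linear_combination -this)
  · have := hent (0, 0) (x, 0)
    simp only [e1, e2, map_mul, map_zero, zero_mul, mul_zero, one_mul, add_zero,
      zero_add] at this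
    exact mul_right_cancel₀ hcx (by linear_combination -this)
  · have := hent (0, 0) (0, 0)
    simp only [e2, map_zero, map_one, mul_zero, mul_one, add_zero, zero_add] at this
    exact this.symm

/-- The coefficients come from a decomposition for a larger second party, with vacuum weight e.
Excitations of the discarded qudits raise it to e', so one extra vacuum vector of weight e' - e,
indexed by `none`, completes the decomposition. -/
theorem sum_binaryTsallis_le_tsallisAssistance {q : ℝ} (hq : 0 < q) (hq' : q ^ 2 - 5 * q + 3 ≤ 0)
    {N : ℕ} {w : Fin N → ℝ} (hw : ∀ i, 0 ≤ w i) {α' β' : Fin N → ℂ} (a : ι → Fin d → ℂ)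
    (b : κ → Fin d → ℂ) {α β : ℂ} {e e' : ℝ} (hee' : e ≤ e')
    (hnorm : ‖α‖ ^ 2 * (wWeight a + wWeight b) + ‖β‖ ^ 2 + e' = 1)
    (hle : ∀ i, ‖α' i‖ ^ 2 * (wWeight a + wWeight b) + ‖β' i‖ ^ 2 ≤ 1)
    (h11 : ∑ i, w i * (α' i * conj (α' i)) = α * conj α)
    (h10 : ∑ i, w i * (α' i * conj (β' i)) = α * conj β)
    (h01 : ∑ i, w i * (β' i * conj (α' i)) = β * conj α)
    (h00 : ∑ i, w i * (β' i * conj (β' i)) = β * conj β + e) :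
    ∑ i, w i * binaryTsallis q (‖α' i‖ ^ 4 * wWeight a * wWeight b) ≤
      tsallisAssistance q (projector (pairVec α β a b) +
        (e' : ℂ) • projector (pairVec 0 1 a b)) := by
  choose ψ hψ1 hψ2 hψ3 using fun i =>
    exists_normalized_pairVec hq hq' (α' i) (β' i) a b rfl (hle i)
  set m : Fin N → ℝ := fun i => ‖α' i‖ ^ 2 * (wWeight a + wWeight b) + ‖β' i‖ ^ 2 with hm
  have hvac : ∑ z, ‖pairVec 0 1 a b z‖ ^ 2 = 1 := by rw [sum_norm_sq_pairVec]; simp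
  have hsum : ∑ i, w i * m i = 1 - (e' - e) := by
    have r1 : ∑ i, w i * ‖α' i‖ ^ 2 = ‖α‖ ^ 2 := by
      simp only [Complex.mul_conj'] at h11
      exact_mod_cast h11
    have r0 : ∑ i, w i * ‖β' i‖ ^ 2 = ‖β‖ ^ 2 + e := by
      simp only [Complex.mul_conj'] at h00
      exact_mod_cast h00
    have : ∀ i, w i * m i = w i * ‖α' i‖ ^ 2 * (wWeight a + wWeight b) + w i * ‖β' i‖ ^ 2 :=
      fun i => by simp only [hm]; ring
    simp_rw [this]
    rw [Finset.sum_add_distrib, ← Finset.sum_mul, r1, r0]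
    linarith
  have key := sum_tsallisPure_le_tsallisAssistance hq (κ := Option (Fin N))
    (ρ := projector (pairVec α β a b) + (e' : ℂ) • projector (pairVec 0 1 a b))
    (fun o => o.elim (e' - e) fun i => w i * m i) (fun o => o.elim (pairVec 0 1 a b) ψ)
    ?_ ?_ ?_ ?_
  · rw [Fintype.sum_option] at key
    simp only [Option.elim] at key
    refine le_trans (Finset.sum_le_sum fun i _ => ?_) (le_trans (le_add_of_nonneg_left
      (mul_nonneg (sub_nonneg.2 hee') (tsallisPure_nonneg hq hvac))) key)
    exact (mul_le_mul_of_nonneg_left (hψ3 i) (hw i)).trans_eq (mul_assoc _ _ _).symm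
  · rintro (_ | i)
    · exact sub_nonneg.2 hee'
    · have := wWeight_nonneg a
      have := wWeight_nonneg b
      exact mul_nonneg (hw i) (by positivity)
  · rw [Fintype.sum_option]
    simp only [Option.elim, hsum]
    ring
  · rintro (_ | i)
    · exact hvac
    · exact hψ1 i
  · rw [Fintype.sum_option]
    simp only [Option.elim]
    have hsc : ∀ i, ((w i * m i : ℝ) : ℂ) • projector (ψ i) =
        (w i : ℂ) • projector (pairVec (α' i) (β' i) a b) := fun i => by
      rw [Complex.ofReal_mul, mul_smul]
      exact congrArg _ (hψ2 i)
    simp_rw [hsc]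
    ext u v
    rw [Matrix.add_apply, Matrix.add_apply, sum_projector_pairVec, h11, h10, h01, h00]
    simp only [Matrix.smul_apply, projector, smul_eq_mul]
    rw [pairVec_eq α β]
    simp only [Pi.add_apply, Pi.smul_apply, smul_eq_mul, map_add, map_mul]
    push_cast
    ring

end

/-! ### Polygamy and the final inequalities -/

theorem wWeight_biUnion {n d : ℕ} [NeZero d] {J : Type} [Fintype J] (a : Fin n → Fin d → ℂ)
    (Q : J → Finset (Fin n)) (hQQ : ∀ i j, i ≠ j → Disjoint (Q i) (Q j)) :
    wWeight (fun s : (Finset.univ.biUnion Q : Finset (Fin n)) => a s) =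
      ∑ j, wWeight (fun s : Q j => a s) := by
  have h : ∀ S : Finset (Fin n), wWeight (fun s : S => a s) =
      ∑ s ∈ S, ∑ i ∈ Finset.univ.erase (0 : Fin d), ‖a s i‖ ^ 2 := fun S =>
    Finset.sum_coe_sort S fun s => ∑ i ∈ Finset.univ.erase (0 : Fin d), ‖a s i‖ ^ 2
  simp_rw [h]
  exact Finset.sum_biUnion fun i _ j _ hij => hQQ i j hij

/-- Polygamy of the Tsallis-`q` entanglement of assistance for generalized `W`-class states
superposed with the vacuum. -/
theorem tsallisAssistance_biUnion_le {n d : ℕ} [NeZero d] {J : Type} [Fintype J] {p : ℝ}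
    (hp0 : 0 ≤ p) (hp1 : p ≤ 1) {a : Fin n → Fin d → ℂ} (ha : wWeight a = 1)
    (P : Finset (Fin n)) (Q : J → Finset (Fin n)) (hPQ : ∀ j, Disjoint P (Q j))
    (hQQ : ∀ i j, i ≠ j → Disjoint (Q i) (Q j)) {q : ℝ} (hq : 0 < q)
    (hq1 : 0 ≤ (q - 2) * (q - 3)) (hq2 : q ^ 2 - 5 * q + 3 ≤ 0) :
    tsallisAssistance q (reduced (gwv p a) P (Finset.univ.biUnion Q)) ≤
      ∑ j, tsallisAssistance q (reduced (gwv p a) P (Q j)) := by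
  have hPR : Disjoint P (Finset.univ.biUnion Q) :=
    (Finset.disjoint_biUnion_right _ _ _).2 fun j _ => hPQ j
  have hnn : 0 ≤ ∑ j, tsallisAssistance q (reduced (gwv p a) P (Q j)) :=
    Finset.sum_nonneg fun j _ => tsallisAssistance_nonneg hq _
  have hB := wWeight_biUnion a Q hQQ
  generalize Finset.univ.biUnion Q = R at hB hPR ⊢
  refine Real.sSup_le ?_ hnn
  rintro t ⟨N, w, ψ, h, rfl⟩
  have hdec := h.decomp
  set A := wWeight (fun s : P => a s) with hA
  set B : J → ℝ := fun j => wWeight (fun s : Q j => a s) with hBdef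
  have hA0 : 0 ≤ A := wWeight_nonneg _
  have hB0 : ∀ j, 0 ≤ B j := fun j => wWeight_nonneg _
  have hBle : ∀ j, B j ≤ ∑ j, B j := fun j =>
    Finset.single_le_sum (fun j _ => hB0 j) (Finset.mem_univ j)
  rw [reduced_gwv hPR hp0] at hdec
  -- Vectors of weight zero are unconstrained by the density matrix; they receive α = β = 0, and the
  -- factor w i keeps the equalities true.
  have hform : ∀ i, ∃ α β : ℂ, w i • ψ i = w i • pairVec α β (fun s : P => a s) (fun s : R => a s) ∧
      ‖α‖ ^ 2 * (A + ∑ j, B j) + ‖β‖ ^ 2 ≤ 1 ∧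
      w i * tsallisPure q (ψ i) = w i * binaryTsallis q (‖α‖ ^ 4 * A * ∑ j, B j) := fun i => by
    by_cases hi : w i = 0
    · exact ⟨0, 0, by simp [hi]⟩
    · obtain ⟨α, β, hαβ⟩ := exists_coeff_of_projector_eq h.nonneg hdec hi
      have hn := h.normalized i
      rw [hαβ, sum_norm_sq_pairVec] at hn
      exact ⟨α, β, by rw [hαβ], by rw [← hB, hn], by rw [hαβ, tsallisPure_pairVec hq _ _ _ _ hn, hB]⟩
  choose α β hψ hle hT using hform
  have hψ' : ∀ i, (w i : ℂ) • projector (ψ i) =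
      (w i : ℂ) • projector (pairVec (α i) (β i) (fun s : P => a s) (fun s : R => a s)) := fun i => by
    by_cases hi : w i = 0
    · simp [hi]
    · rw [smul_right_injective _ hi (hψ i)]
  simp_rw [hψ'] at hdec
  simp_rw [hT]
  -- If P carries no excitation, the coefficients cannot be recovered, but all the terms on the left
  -- vanish.
  rcases hA0.eq_or_lt with hA' | hA'
  · simpa [← hA', binaryTsallis_zero hq] using hnn
  obtain ⟨h11, h10, h01, h00⟩ := sum_coeff_of_projector_eq hA'.ne' hdec
  have hsub : ∀ i, binaryTsallis q (‖α i‖ ^ 4 * A * ∑ j, B j) ≤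
      ∑ j, binaryTsallis q (‖α i‖ ^ 4 * A * B j) := fun i => by
    have hs0 : 0 ≤ ∑ j, B j := Finset.sum_nonneg fun j _ => hB0 j
    rw [Finset.mul_sum]
    refine binaryTsallis_sum_le hq hq1 _ _ (fun j _ => by have := hB0 j; positivity) ?_
    rw [← Finset.mul_sum]
    have h1 : ‖α i‖ ^ 2 * (A + ∑ j, B j) ≤ 1 := by linarith [hle i, sq_nonneg ‖β i‖]
    have h2 : 0 ≤ ‖α i‖ ^ 2 * (A + ∑ j, B j) := by positivity
    -- The product of two nonnegative numbers with sum at most 1 is at most 1/4.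
    nlinarith [sq_nonneg (‖α i‖ ^ 2 * (A - ∑ j, B j))]
  calc ∑ i, w i * binaryTsallis q (‖α i‖ ^ 4 * A * ∑ j, B j)
      ≤ ∑ i, ∑ j, w i * binaryTsallis q (‖α i‖ ^ 4 * A * B j) :=
        Finset.sum_le_sum fun i _ => by
          rw [← Finset.mul_sum]
          exact mul_le_mul_of_nonneg_left (hsub i) (h.nonneg i)
    _ = ∑ j, ∑ i, w i * binaryTsallis q (‖α i‖ ^ 4 * A * B j) := Finset.sum_comm
    _ ≤ _ := Finset.sum_le_sum fun j _ => by
      rw [reduced_gwv (hPQ j) hp0]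
      refine sum_binaryTsallis_le_tsallisAssistance hq hq2 h.nonneg _ _ ?_ ?_ (fun i => ?_)
        h11 h10 h01 h00
      · rw [hB]
        exact mul_le_mul_of_nonneg_left (by linarith [hBle j]) hp0
      · rw [Complex.norm_real, Complex.norm_real, Real.norm_of_nonneg (Real.sqrt_nonneg _),
          Real.norm_of_nonneg (Real.sqrt_nonneg _), Real.sq_sqrt hp0,
          Real.sq_sqrt (sub_nonneg.2 hp1), ha]
        ring
      · refine le_trans ?_ (hle i)
        have := mul_le_mul_of_nonneg_left (hBle j) (sq_nonneg ‖α i‖)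
        simp only [mul_add]
        linarith

theorem tsallisAssistance_biUnion_rpow_le {n d r : ℕ} [NeZero d] {p : ℝ}
    (hp0 : 0 ≤ p) (hp1 : p ≤ 1) {a : Fin n → Fin d → ℂ} (ha : wWeight a = 1)
    (P : Finset (Fin n)) (Q : Fin r → Finset (Fin n)) (hPQ : ∀ j, Disjoint P (Q j))
    (hQQ : ∀ i j, i ≠ j → Disjoint (Q i) (Q j)) {q : ℝ} (hq : 0 < q)
    (hq1 : 0 ≤ (q - 2) * (q - 3)) (hq2 : q ^ 2 - 5 * q + 3 ≤ 0)
    {μ : ℝ} (hμ0 : 0 < μ) (hμ1 : μ ≤ 1) {k : ℝ} (hk : 0 < k) (hk1 : k ≤ 1)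
    (hkt : ∀ i j : Fin r, (j : ℕ) = (i : ℕ) + 1 →
        tsallisAssistance q (reduced (gwv p a) P (Q j)) ≤
          k * tsallisAssistance q (reduced (gwv p a) P (Q i))) :
    tsallisAssistance q (reduced (gwv p a) P (Finset.univ.biUnion Q)) ^ μ ≤
      ∑ j : Fin r, weightK k μ ^ hammingWeight j *
        tsallisAssistance q (reduced (gwv p a) P (Q j)) ^ μ :=
  (Real.rpow_le_rpow (tsallisAssistance_nonneg hq _)
    (tsallisAssistance_biUnion_le hp0 hp1 ha P Q hPQ hQQ hq hq1 hq2) hμ0.le).trans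
    (sum_fin_rpow_le hk hk1 hμ0 hμ1 _ (fun _ => tsallisAssistance_nonneg hq _) hkt)

end GWV

theorem theorem5 {n d r : ℕ} [NeZero d] (hr : 1 ≤ r)
    (p : ℝ) (hp0 : 0 ≤ p) (hp1 : p ≤ 1)
    (a : Fin n → Fin d → ℂ)
    (ha : ∑ s : Fin n, ∑ i ∈ Finset.univ.erase (0 : Fin d), ‖a s i‖ ^ 2 = 1)
    (P : Finset (Fin n)) (Q : Fin r → Finset (Fin n))
    (hP : P.Nonempty) (hQ : ∀ j, (Q j).Nonempty)
    (hPQ : ∀ j, Disjoint P (Q j)) (hQQ : ∀ i j, i ≠ j → Disjoint (Q i) (Q j))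
    (q : ℝ) (hq : q ∈ Set.Icc ((5 - Real.sqrt 13) / 2) 2 ∪ Set.Icc 3 ((5 + Real.sqrt 13) / 2))
    (μ : ℝ) (hμ0 : 0 < μ) (hμ1 : μ ≤ 1) :
    (∀ k : ℝ, 0 < k → k ≤ 1 →
      (∀ i j : Fin r, (j : ℕ) = (i : ℕ) + 1 →
        GWV.tsallisAssistance q (GWV.reduced (GWV.gwv p a) P (Q j)) ≤
          k * GWV.tsallisAssistance q (GWV.reduced (GWV.gwv p a) P (Q i))) →
      GWV.tsallisAssistance q
          (GWV.reduced (GWV.gwv p a) P (Finset.univ.biUnion Q)) ^ μ ≤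
        ∑ j : Fin r, GWV.weightK k μ ^ GWV.hammingWeight j *
          GWV.tsallisAssistance q (GWV.reduced (GWV.gwv p a) P (Q j)) ^ μ) ∧
    (∃ σ : Equiv.Perm (Fin r),
      Antitone (fun j : Fin r =>
        GWV.tsallisAssistance q (GWV.reduced (GWV.gwv p a) P (Q (σ j)))) ∧
      GWV.tsallisAssistance q
          (GWV.reduced (GWV.gwv p a) P (Finset.univ.biUnion Q)) ^ μ ≤
        ∑ j : Fin r, ((2 : ℝ) ^ μ - 1) ^ GWV.hammingWeight j *
          GWV.tsallisAssistance q (GWV.reduced (GWV.gwv p a) P (Q (σ j))) ^ μ) := by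
  obtain ⟨hq0, hq1, hq2⟩ := GWV.pos_and_bounds_of_mem hq
  refine ⟨fun k hk hk1 hkt => GWV.tsallisAssistance_biUnion_rpow_le hp0 hp1 ha P Q hPQ hQQ hq0 hq1
    hq2 hμ0 hμ1 hk hk1 hkt, ?_⟩
  set t : Fin r → ℝ := fun j => GWV.tsallisAssistance q (GWV.reduced (GWV.gwv p a) P (Q j)) with ht
  -- Sorting the negatives gives a decreasing order, which is the ratio condition with k = 1, where
  -- K_μ = 2^μ - 1.
  let σ := Tuple.sort (fun j => -t j)
  have hσ : Antitone (fun j => t (σ j)) := fun i j hij =>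
    neg_le_neg_iff.1 (Tuple.monotone_sort (fun j => -t j) hij)
  refine ⟨σ, hσ, ?_⟩
  have key := GWV.tsallisAssistance_biUnion_rpow_le hp0 hp1 ha P (Q ∘ σ) (fun j => hPQ _)
    (fun i j hij => hQQ _ _ (σ.injective.ne hij)) hq0 hq1 hq2 hμ0 hμ1 one_pos le_rfl
    (fun i j hij => by
      rw [one_mul]
      exact hσ (Fin.le_def.2 (by omega)))
  have hU : Finset.univ.biUnion (Q ∘ σ) = Finset.univ.biUnion Q := by
    ext s
    simp [σ.exists_congr_left (p := fun j => s ∈ Q (σ j))]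
  rw [hU, GWV.weightK_one] at key
  exact key
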